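/- Let $\overline{\mathbb{Q}}$ be an algebraic closure of $\mathbb{Q}$, let $h$ be the absolute logarithmic Weil height on $\overline{\mathbb{Q}}$, and for $\gamma\in\mathbb{R}$ and $a\in\overline{\mathbb{Q}}$ put $h_\gamma(a):=[\mathbb{Q}(a):\mathbb{Q}]^{\gamma}\,h(a)$. For $A\subset\overline{\mathbb{Q}}$ let $\mu_A$ be the set of roots of unity in $A$, and for $C>0$ put $N_\gamma(A,C):=\#\{a\in A : h_\gamma(a)<C\}$. Say that $A$ has the $\gamma$-Northcott property if $N_\gamma(A,C)<\infty$ for all $C>0$, and the $\gamma$-Bogomolov property if $N_\gamma(A\setminus\mu_A,C)<\infty$ for some $C>0$. Let $I_N(A)$ (resp. $I_B(A)$) be the set of all $\gamma\in\mathbb{R}$ for which $A$ has the $\gamma$-Northcott (resp. $\gamma$-Bogomolov) property. **Proposition 5.1.** Let $(p_i)_{i\ge1}$ and $(q_i)_{i\ge1}$ be strictly increasing sequences of prime numbers such that $p_i<q_i<2p_i$ and $q_i<p_{i+1}$ for all $i$. For each $i$ let $(p_i/q_i)^{1/p_i}\in\overline{\mathbb{Q}}$ denote any $p_i$-th root of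 $p_i/q_i$, and let $L:=\mathbb{Q}\bigl((p_i/q_i)^{1/p_i} : i\ge1\bigr)\subset\overline{\mathbb{Q}}$. Then $$I_N(L)=I_B(L)=[1,\infty).$$ In particular, there exists a field $L\subset\overline{\mathbb{Q}}$ with $I_N(L)=I_B(L)=[1,\infty)$. -/

import Mathlib

open IntermediateField

/-- The field of algebraic numbers. -/
abbrev QBar : Type := AlgebraicClosure ℚ

namespace WeightedHeight

/-- The degree `[ℚ(a) : ℚ]` of an algebraic number. -/
noncomputable def deg (a : QBar) : ℕ := Module.finrank ℚ ℚ⟮a⟯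

/-- The `γ`-weighted Weil height `h_γ(a) = deg(a)^γ h(a)`, where `h` is the absolute logarithmic
Weil height. -/
noncomputable def height (γ : ℝ) (a : QBar) : ℝ :=
  (deg a : ℝ) ^ γ * NumberField.absLogHeight₁ a

/-- The number `N_γ(A, C)` of elements of `A` with `γ`-weighted height less than `C`
(possibly infinite). -/
noncomputable def count (γ : ℝ) (A : Set QBar) (C : ℝ) : ℕ∞ :=
  {a ∈ A | height γ a < C}.encard

/-- The set `μ_A` of roots of unity in `A`. -/
def rootsOfUnityIn (A : Set QBar) : Set QBar :=
  {a ∈ A | ∃ n : ℕ, 0 < n ∧ a ^ n = 1}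

/-- The `γ`-Northcott property. -/
def HasNorthcott (γ : ℝ) (A : Set QBar) : Prop :=
  ∀ C : ℝ, 0 < C → count γ A C < ⊤

/-- The `γ`-Bogomolov property. -/
def HasBogomolov (γ : ℝ) (A : Set QBar) : Prop :=
  ∃ C : ℝ, 0 < C ∧ count γ (A \ rootsOfUnityIn A) C < ⊤

/-- The set `I_N(A)` of real `γ` for which `A` has the `γ`-Northcott property. -/
def northcottSet (A : Set QBar) : Set ℝ := {γ | HasNorthcott γ A}

/-- The set `I_B(A)` of real `γ` for which `A` has the `γ`-Bogomolov property. -/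
def bogomolovSet (A : Set QBar) : Set ℝ := {γ | HasBogomolov γ A}

end WeightedHeight

namespace WeightedHeight

open NumberField Height Module

/-! ### Heights under extension of number fields, and the absolute height -/

section Functoriality

/-! Since `γ`-Northcott implies `γ`-Bogomolov, it suffices to prove Northcott for `γ ≥ 1` and to
refute Bogomolov for `γ < 1`.

For `γ < 1`, the generator `α i` has degree `p i` and height `log (q i) / p i`. Hence `h_γ(α i) = (p
i)^(γ-1) log (q i)` tends to `0` along infinitely many elements that are not roots of unity.

For `γ ≥ 1`, write `L` as the union of the fields `K_i` generated by the `α j` with `j < i`. The key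
claim is `deg a * h(a) ≥ (log p - log 2) / 2`, `p = p i`, for `a` in `K_{i+1}` but not in `K_i`
(`log_sub_log_le_deg_mul_absLogHeight₁`). As this tends to infinity, elements of bounded `h_γ` lie
in one `K_N`, where Northcott's theorem applies.

To prove the claim, enlarge `K_i` to a Galois number field `F` containing a primitive `p`-th root of
unity `ζ`, of degree prime to `p`. Ramification at `p` in `F` is then prime to `p`, so `F(α)/F` is
totally ramified of degree `p` above `p`. Let `σ` send `α` to `ζ α`. Expanding `a` in powers of `α`
shows that `a^p` and `σ(a)^p` are congruent modulo `p`, up to denominators. If they differ, the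
product formula gives `2 p h(a) ≥ log p - log 2`, while `deg a ≥ p`. If they agree, then `a = c α^m`
with `c ∈ F` and `0 < m < p`. In that case `b = a^p` lies in `F` and is not a unit above `p`, so
`deg b * h(b) ≥ log p`; conclude by `h(b) = p h(a)` and `p deg b ≤ deg a`. -/

lemma card_embeddings_over {K M : Type*} [Field K] [Field M] [NumberField K] [NumberField M]
    [Algebra K M] [DecidableEq (K →+* ℂ)] (φ : K →+* ℂ) :
    (Finset.univ.filter fun ψ : M →+* ℂ ↦ ψ.comp (algebraMap K M) = φ).card = finrank K M := by
  let _ : Algebra K ℂ := φ.toAlgebra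
  have : FiniteDimensional K M := FiniteDimensional.right ℚ K M
  rw [← AlgHom.card K M ℂ, ← Fintype.card_subtype]
  refine Fintype.card_congr
    { toFun := fun ψ ↦ { ψ.1 with commutes' := fun r ↦ DFunLike.congr_fun ψ.2 r }
      invFun := fun σ ↦ ⟨σ.toRingHom, by ext r; exact σ.commutes r⟩
      left_inv := fun ψ ↦ rfl
      right_inv := fun σ ↦ rfl }

lemma prod_embeddings_comp {K M : Type*} [Field K] [Field M] [NumberField K] [NumberField M]
    [Algebra K M] (G : (K →+* ℂ) → ℝ) :
    ∏ ψ : M →+* ℂ, G (ψ.comp (algebraMap K M)) = (∏ φ : K →+* ℂ, G φ) ^ finrank K M := by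
  classical
  rw [← Finset.prod_fiberwise Finset.univ (fun ψ : M →+* ℂ ↦ ψ.comp (algebraMap K M)),
    ← Finset.prod_pow]
  refine Finset.prod_congr rfl fun φ _ ↦ ?_
  rw [← card_embeddings_over (M := M) φ, ← Finset.prod_const]
  refine Finset.prod_congr rfl fun ψ hψ ↦ ?_
  rw [(Finset.mem_filter.mp hψ).2]

lemma prod_infinitePlace_pow_mult {K : Type*} [Field K] [NumberField K] (F : InfinitePlace K → ℝ) :
    ∏ v : InfinitePlace K, F v ^ v.mult = ∏ φ : K →+* ℂ, F (InfinitePlace.mk φ) := by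
  classical
  rw [← Finset.prod_fiberwise Finset.univ InfinitePlace.mk (fun φ => F (InfinitePlace.mk φ))]
  refine Finset.prod_congr rfl fun v _ ↦ ?_
  rw [← InfinitePlace.card_filter_mk_eq v, ← Finset.prod_const]
  refine Finset.prod_congr rfl fun ψ hψ ↦ ?_
  rw [(Finset.mem_filter.mp hψ).2]

lemma iSup_fin_two (f : Fin 2 → ℝ) : ⨆ i, f i = max (f 0) (f 1) := by
  refine le_antisymm (ciSup_le fun i ↦ ?_) (max_le ?_ ?_)
  · fin_cases i <;> simp
  · exact Finite.le_ciSup_of_le 0 le_rfl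
  · exact Finite.le_ciSup_of_le 1 le_rfl

/-- The height of the fraction `a / n` through embeddings and the norm of the ideal `(a, n)`. -/
lemma absNorm_mul_mulHeight₁_div {K : Type*} [Field K] [NumberField K] (a : 𝓞 K) {n : ℕ}
    (hn : n ≠ 0) :
    (Ideal.absNorm (Ideal.span {a, (n : 𝓞 K)}) : ℝ) * mulHeight₁ ((a : K) / n) =
      ∏ φ : K →+* ℂ, max ‖φ a‖ n := by
  have hv (i : Fin 2) : (![a, (n : 𝓞 K)] i : K) = ![(a : K), n] i := by fin_cases i <;> simp
  have h := absNorm_mul_finprod_finitePlace_eq_one (K := K) (show ![a, (n : 𝓞 K)] ≠ 0 by simp [hn])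
  rw [mulHeight₁_div_eq_mulHeight, NumberField.mulHeight_eq (by simp [hn]), mul_left_comm]
  simp only [hv, Matrix.range_cons, Matrix.range_empty, Set.union_empty, Set.singleton_union] at h
  rw [h, mul_one, prod_infinitePlace_pow_mult]
  refine Finset.prod_congr rfl fun φ _ ↦ ?_
  rw [iSup_fin_two]
  simp

lemma absNorm_span_map {K M : Type*} [Field K] [Field M] [NumberField K] [NumberField M]
    [Algebra K M] (a : 𝓞 K) (n : ℕ) :
    Ideal.absNorm (Ideal.span {algebraMap (𝓞 K) (𝓞 M) a, (n : 𝓞 M)}) =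
      Ideal.absNorm (Ideal.span {a, (n : 𝓞 K)}) ^ finrank K M := by
  have h3 : Ideal.span {algebraMap (𝓞 K) (𝓞 M) a, (n : 𝓞 M)} =
      (Ideal.span {a, (n : 𝓞 K)}).map (algebraMap (𝓞 K) (𝓞 M)) := by
    rw [Ideal.map_span, Set.image_pair, map_natCast]
  rw [h3, Ideal.absNorm_algebraMap, IsFractionRing.finrank_eq (𝓞 K) K (𝓞 M) M]

/-- Passing from `K` to `M` raises both the product over embeddings and the norm of the ideal `(a,
n)` to the power `[M : K]`; the norm is nonzero and cancels. No place-by-place analysis of the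
extension is needed. -/
lemma mulHeight₁_algebraMap_div {K M : Type*} [Field K] [Field M] [NumberField K] [NumberField M]
    [Algebra K M] (a : 𝓞 K) {n : ℕ} (hn : n ≠ 0) :
    mulHeight₁ (algebraMap K M a / n) = mulHeight₁ ((a : K) / n) ^ finrank K M := by
  have h1 := absNorm_mul_mulHeight₁_div a hn
  have h2 := absNorm_mul_mulHeight₁_div (algebraMap (𝓞 K) (𝓞 M) a) hn
  have h4 : ((algebraMap (𝓞 K) (𝓞 M) a : 𝓞 M) : M) = algebraMap K M a := by
    rw [RingOfIntegers.coe_eq_algebraMap, RingOfIntegers.coe_eq_algebraMap,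
      ← IsScalarTower.algebraMap_apply, ← IsScalarTower.algebraMap_apply]
  have h6 := prod_embeddings_comp (K := K) (M := M) fun φ ↦ max ‖φ a‖ n
  simp only [RingHom.comp_apply] at h6
  rw [absNorm_span_map, h4, h6, ← h1, mul_pow, Nat.cast_pow] at h2
  refine mul_left_cancel₀ (pow_ne_zero _ ?_) h2
  have : Ideal.span {a, (n : 𝓞 K)} ≠ ⊥ := by
    rw [Ne, Ideal.span_eq_bot]
    intro h
    have := h n (by simp)
    simp [hn] at this
  exact_mod_cast mt Ideal.absNorm_eq_zero_iff.mp this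

lemma mulHeight₁_algebraMap {K M : Type*} [Field K] [Field M] [NumberField K] [NumberField M]
    [Algebra K M] (x : K) :
    mulHeight₁ (algebraMap K M x) = mulHeight₁ x ^ finrank K M := by
  obtain ⟨n, hn, a, ha, -⟩ := exists_nat_ne_zero_exists_integer_mul_eq_and_absNorm_span_eq_pow x
  have hn' : (n : K) ≠ 0 := mod_cast hn
  obtain rfl : x = a / n := by rw [← ha, mul_div_cancel_left₀ x hn']
  rw [map_div₀, map_natCast, mulHeight₁_algebraMap_div a hn]

lemma logHeight₁_map {K M : Type*} [Field K] [Field M] [NumberField K] [NumberField M]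
    (f : K →+* M) (x : K) :
    finrank ℚ K * logHeight₁ (f x) = finrank ℚ M * logHeight₁ x := by
  let _ : Algebra K M := f.toAlgebra
  have h : f x = algebraMap K M x := rfl
  rw [h, logHeight₁_eq_log_mulHeight₁, mulHeight₁_algebraMap, Real.log_pow,
    ← finrank_mul_finrank ℚ K M, logHeight₁_eq_log_mulHeight₁]
  push_cast
  ring

/-- The absolute height is defined through `ℚ(f x)`; this allows it to be computed in any number
field containing the element. -/
lemma finrank_mul_absLogHeight₁ {K : Type*} [Field K] [NumberField K] (f : K →+* QBar) (x : K) :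
    finrank ℚ K * absLogHeight₁ (f x) = logHeight₁ x := by
  have hx : IsIntegral ℚ (f x) := (AlgebraicClosure.isAlgebraic ℚ).isAlgebraic _ |>.isIntegral
  have : FiniteDimensional ℚ ℚ⟮f x⟯ := adjoin.finiteDimensional hx
  have : NumberField ℚ⟮f x⟯ := {}
  have hr : ℚ⟮f x⟯ ≤ (f.toRatAlgHom).fieldRange := by
    rw [adjoin_simple_le_iff]
    exact ⟨x, rfl⟩
  let e : K ≃ₐ[ℚ] (f.toRatAlgHom).fieldRange := AlgEquiv.ofInjectiveField _
  let g : ℚ⟮f x⟯ →ₐ[ℚ] K := e.symm.toAlgHom.comp (inclusion hr)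
  have hg : g (AdjoinSimple.gen ℚ (f x)) = x := by
    apply e.injective
    change e (e.symm (inclusion hr (AdjoinSimple.gen ℚ (f x)))) = e x
    rw [AlgEquiv.apply_symm_apply]
    rfl
  have key := logHeight₁_map (g : ℚ⟮f x⟯ →+* K) (AdjoinSimple.gen ℚ (f x))
  simp only [RingHom.coe_coe, hg] at key
  have hpos : (finrank ℚ ℚ⟮f x⟯ : ℝ) ≠ 0 := by exact_mod_cast finrank_pos.ne'
  rw [absLogHeight₁, absMulHeight₁, dif_pos hx, Real.log_rpow (mulHeight₁_pos _),
    ← logHeight₁_eq_log_mulHeight₁]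
  field_simp
  linarith

lemma absLogHeight₁_nonneg (a : QBar) : 0 ≤ absLogHeight₁ a := by
  have hx : IsIntegral ℚ a := (AlgebraicClosure.isAlgebraic ℚ).isAlgebraic _ |>.isIntegral
  have : FiniteDimensional ℚ ℚ⟮a⟯ := adjoin.finiteDimensional hx
  have : NumberField ℚ⟮a⟯ := {}
  have h := finrank_mul_absLogHeight₁ (algebraMap ℚ⟮a⟯ QBar) (AdjoinSimple.gen ℚ a)
  have h0 := zero_le_logHeight₁ (AdjoinSimple.gen ℚ a)
  rw [← h, AdjoinSimple.algebraMap_gen] at h0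
  have hpos : (0 : ℝ) < finrank ℚ ℚ⟮a⟯ := by exact_mod_cast finrank_pos
  exact nonneg_of_mul_nonneg_right h0 hpos

lemma absLogHeight₁_pow (a : QBar) (n : ℕ) : absLogHeight₁ (a ^ n) = n * absLogHeight₁ a := by
  have hx : IsIntegral ℚ a := (AlgebraicClosure.isAlgebraic ℚ).isAlgebraic _ |>.isIntegral
  have : FiniteDimensional ℚ ℚ⟮a⟯ := adjoin.finiteDimensional hx
  have : NumberField ℚ⟮a⟯ := {}
  have h := finrank_mul_absLogHeight₁ (algebraMap ℚ⟮a⟯ QBar) (AdjoinSimple.gen ℚ a)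
  have h' := finrank_mul_absLogHeight₁ (algebraMap ℚ⟮a⟯ QBar) (AdjoinSimple.gen ℚ a ^ n)
  rw [logHeight₁_pow, ← h, map_pow, AdjoinSimple.algebraMap_gen] at h'
  have hpos : (finrank ℚ ℚ⟮a⟯ : ℝ) ≠ 0 := by exact_mod_cast finrank_pos.ne'
  refine mul_left_cancel₀ hpos ?_
  rw [h']
  ring

lemma deg_pos (a : QBar) : 0 < deg a := by
  have hx : IsIntegral ℚ a := (AlgebraicClosure.isAlgebraic ℚ).isAlgebraic _ |>.isIntegral
  have : FiniteDimensional ℚ ℚ⟮a⟯ := adjoin.finiteDimensional hx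
  exact finrank_pos

lemma absLogHeight₁_ratCast_div {m n : ℕ} (hm : 0 < m) (hmn : m.Coprime n) (h : m ≤ n) :
    absLogHeight₁ ((m : QBar) / n) = Real.log n := by
  have hn : 0 < n := hm.trans_le h
  have key := finrank_mul_absLogHeight₁ (algebraMap ℚ QBar) ((m : ℚ) / n)
  have hd : ((m : ℚ) / n).den = n := by
    have := Rat.den_div_eq_of_coprime (a := m) (b := n) (by exact_mod_cast hn) (by simpa using hmn)
    simpa using this
  have hu : ((m : ℚ) / n).num = m := by
    have := Rat.num_div_eq_of_coprime (a := m) (b := n) (by exact_mod_cast hn) (by simpa using hmn)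
    simpa using this
  rw [Rat.logHeight₁_eq_log_max, hd, hu, map_div₀, map_natCast, map_natCast] at key
  simpa [h] using key

/-- The Northcott property of a number field inside `QBar`, in terms of the absolute height. -/
lemma finite_mem_absLogHeight₁_le (K : IntermediateField ℚ QBar) [FiniteDimensional ℚ K] (B : ℝ) :
    {a : QBar | a ∈ K ∧ absLogHeight₁ a ≤ B}.Finite := by
  have : NumberField K := {}
  refine ((finite_setOfPred_logHeight₁_le K (finrank ℚ K * B)).image (algebraMap K QBar)).subset ?_
  rintro a ⟨ha, hB⟩
  refine ⟨⟨a, ha⟩, ?_, rfl⟩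
  have h := finrank_mul_absLogHeight₁ (algebraMap K QBar) ⟨a, ha⟩
  change logHeight₁ _ ≤ _
  rw [← h]
  exact mul_le_mul_of_nonneg_left hB (Nat.cast_nonneg _)

end Functoriality

/-! ### Finite places: restriction to subfields and ramification -/

section Places

open IsDedekindDomain HeightOneSpectrum

variable {K : Type*} [Field K] [NumberField K]

lemma finitePlace_eq_toNNReal (u : FinitePlace K) (x : K) :
    u x = WithZeroMulInt.toNNReal (absNorm_ne_zero u.maximalIdeal)
      (u.maximalIdeal.valuation K x) := by
  rw [← FinitePlace.norm_embedding', FinitePlace.norm_embedding_eq]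

lemma finitePlace_lt_one_iff (u : FinitePlace K) (x : K) :
    u x < 1 ↔ u.maximalIdeal.valuation K x < 1 := by
  rw [finitePlace_eq_toNNReal]
  have h := (WithZeroMulInt.toNNReal_strictMono (one_lt_absNorm_nnreal u.maximalIdeal)).lt_iff_lt
    (a := u.maximalIdeal.valuation K x) (b := 1)
  rw [map_one] at h
  rw [← h]
  exact_mod_cast Iff.rfl

lemma finitePlace_eq_one_iff (u : FinitePlace K) (x : K) :
    u x = 1 ↔ u.maximalIdeal.valuation K x = 1 := by
  rw [finitePlace_eq_toNNReal]
  have h := (WithZeroMulInt.toNNReal_strictMono (one_lt_absNorm_nnreal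
    u.maximalIdeal)).injective.eq_iff (a := u.maximalIdeal.valuation K x) (b := 1)
  rw [map_one] at h
  rw [← h]
  exact_mod_cast Iff.rfl

lemma finitePlace_add_le (u : FinitePlace K) (x y : K) : u (x + y) ≤ max (u x) (u y) :=
  FinitePlace.add_le u x y

lemma finitePlace_natCast_le_one (u : FinitePlace K) (n : ℕ) : u n ≤ 1 := by
  have := adicAbv_natCast_le_one K u.maximalIdeal n
  rwa [← FinitePlace.norm_embedding, FinitePlace.norm_embedding_eq] at this

/-- The restriction of a finite place to a subfield. -/
lemma exists_finitePlace_below {M : Type*} [Field M] [NumberField M] [Algebra K M]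
    (w : FinitePlace M) : ∃ u : FinitePlace K, ∀ x : K,
      (w (algebraMap K M x) = 1 ↔ u x = 1) ∧ (w (algebraMap K M x) < 1 ↔ u x < 1) := by
  let P := w.maximalIdeal
  let v : HeightOneSpectrum (𝓞 K) := P.under (𝓞 K)
  have : P.asIdeal.LiesOver v.asIdeal := ⟨rfl⟩
  have he : v.asIdeal.ramificationIdx' P.asIdeal ≠ 0 :=
    Ideal.IsDedekindDomain.ramificationIdx'_ne_zero_of_liesOver P.asIdeal v.ne_bot
  refine ⟨FinitePlace.mk v, fun x ↦ ?_⟩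
  rw [finitePlace_eq_one_iff, finitePlace_eq_one_iff, finitePlace_lt_one_iff,
    finitePlace_lt_one_iff, FinitePlace.maximalIdeal_mk, ← valuation_liesOver M v P]
  exact ⟨pow_eq_one_iff_of_nonneg zero_le he, pow_lt_one_iff he⟩

/-- In a Galois number field of degree prime to `p`, the ramification index at `p` is prime
to `p`. -/
lemma dvd_of_finitePlace_pow_eq [IsGalois ℚ K] {p : ℕ} (hp : p.Prime) (hK : ¬ p ∣ finrank ℚ K)
    (u : FinitePlace K) (hu : u p < 1) {c : K} (hc : c ≠ 0) {j : ℤ} (h : u c ^ p = u p ^ j) :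
    (p : ℤ) ∣ j := by
  let P := u.maximalIdeal
  have : Fact p.Prime := ⟨hp⟩
  have hpZ : Prime (p : ℤ) := Nat.prime_iff_prime_int.mp hp
  let π : HeightOneSpectrum ℤ := ⟨Ideal.span {(p : ℤ)},
    (Ideal.span_singleton_prime hpZ.ne_zero).mpr hpZ, by simpa using hp.ne_zero⟩
  have hpP : ((p : ℕ) : 𝓞 K) ∈ P.asIdeal := by
    rw [finitePlace_lt_one_iff] at hu
    rw [← valuation_lt_one_iff_mem (K := K)]
    simpa using hu
  have hover : P.asIdeal.LiesOver π.asIdeal := by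
    refine ⟨π.isMaximal.eq_of_le (Ideal.IsPrime.under ℤ P.asIdeal).ne_top ?_⟩
    rw [Ideal.span_singleton_le_iff_mem, Ideal.mem_comap]
    simpa using hpP
  have hval := valuation_liesOver K (K := ℚ) π P p
  -- In a Galois extension all primes above `p` share one ramification index, which divides the
  -- degree by `e f g = n`.
  have hdvd : π.asIdeal.ramificationIdx' P.asIdeal ∣ finrank ℚ K := by
    rw [Ideal.ramificationIdx'_eq_ramificationIdx π.asIdeal P.asIdeal π.ne_bot,
      ← Ideal.ramificationIdxIn_eq_ramificationIdx π.asIdeal P.asIdeal Gal(K/ℚ),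
      ← IsGalois.card_aut_eq_finrank ℚ K,
      ← Ideal.ncard_primesOver_mul_ramificationIdxIn_mul_inertiaDegIn π.asIdeal (𝓞 K) Gal(K/ℚ)]
    exact (dvd_mul_right _ _).mul_left _
  have hπ : π.valuation ℚ (p : ℚ) = WithZero.exp (-1 : ℤ) := by
    have h1 := π.intValuation_singleton hpZ.ne_zero rfl
    rw [← h1, ← π.valuation_of_algebraMap (K := ℚ)]
    simp
  obtain ⟨k, hk⟩ : ∃ k : ℤ, WithZero.exp k = P.valuation K c :=
    ⟨_, WithZero.exp_log ((P.valuation K).ne_zero_iff.mpr hc)⟩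
  have hpow : P.valuation K c ^ p = P.valuation K p ^ j := by
    rw [finitePlace_eq_toNNReal, finitePlace_eq_toNNReal] at h
    apply (WithZeroMulInt.toNNReal_strictMono (one_lt_absNorm_nnreal P)).injective
    rw [map_pow, map_zpow₀]
    exact_mod_cast h
  rw [hπ, map_natCast] at hval
  rw [← hval, ← hk, ← WithZero.exp_nsmul, ← WithZero.exp_nsmul, ← WithZero.exp_zsmul,
    WithZero.exp_inj] at hpow
  set e := π.asIdeal.ramificationIdx' P.asIdeal
  -- In exponents the hypothesis reads `p * k = -(j * e)`.
  have h1 : (p : ℤ) ∣ j * e := ⟨-k, by simp at hpow; linarith⟩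
  refine (hpZ.dvd_or_dvd h1).resolve_right fun h2 ↦ hK ?_
  exact (Int.natCast_dvd_natCast.mp h2).trans hdvd

end Places

/-! ### Congruences for `p`-th powers in totally ramified extensions -/

section TotallyRamified

variable {M : Type*} [Field M] [NumberField M]

lemma finitePlace_sum_le {ι : Type*} (w : FinitePlace M) (s : Finset ι) (f : ι → M) {B : ℝ}
    (hB : 0 ≤ B) (h : ∀ i ∈ s, w (f i) ≤ B) : w (∑ i ∈ s, f i) ≤ B := by
  classical
  induction s using Finset.induction_on with
  | empty => simpa using hB
  | insert i s his ih =>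
    rw [Finset.sum_insert his]
    exact (finitePlace_add_le w _ _).trans (max_le (h i (by simp))
      (ih fun j hj ↦ h j (by simp [hj])))

/-- The inner binomial coefficients of the `p`-th power are divisible by `p`. -/
lemma finitePlace_add_pow_sub_le (w : FinitePlace M) {p : ℕ} (hp : p.Prime) {x y : M} {R : ℝ}
    (hx : w x ≤ R) (hy : w y ≤ R) : w ((x + y) ^ p - x ^ p - y ^ p) ≤ w p * R ^ p := by
  have hR : 0 ≤ R := (apply_nonneg w x).trans hx
  rw [add_pow_prime_eq hp, add_assoc, add_sub_cancel_left, add_sub_cancel_left, mul_assoc,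
    mul_assoc, map_mul, ← mul_assoc, Finset.mul_sum]
  refine mul_le_mul_of_nonneg_left ?_ (apply_nonneg w _)
  refine finitePlace_sum_le w _ _ (by positivity) fun k hk ↦ ?_
  rw [Finset.mem_Ioo] at hk
  have he : x * y * (x ^ (k - 1) * y ^ (p - k - 1) * ((p.choose k / p : ℕ) : M)) =
      x ^ k * y ^ (p - k) * ((p.choose k / p : ℕ) : M) := by
    obtain ⟨i, rfl⟩ : ∃ i, k = i + 1 := ⟨k - 1, by omega⟩
    obtain ⟨j, hj⟩ : ∃ j, p - (i + 1) = j + 1 := ⟨p - (i + 1) - 1, by omega⟩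
    rw [hj, Nat.add_sub_cancel, Nat.add_sub_cancel]
    ring
  rw [he, map_mul, map_mul, map_pow, map_pow]
  calc w x ^ k * w y ^ (p - k) * w ((p.choose k / p : ℕ) : M) ≤ R ^ k * R ^ (p - k) * 1 := by
        gcongr
        exact finitePlace_natCast_le_one w _
    _ = R ^ p := by rw [mul_one, ← pow_add, Nat.add_sub_of_le hk.2.le]

lemma finitePlace_sum_pow_sub_le {ι : Type*} (w : FinitePlace M) {p : ℕ} (hp : p.Prime)
    (s : Finset ι) (x : ι → M) {R : ℝ} (hR : 0 ≤ R) (hx : ∀ i ∈ s, w (x i) ≤ R) :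
    w ((∑ i ∈ s, x i) ^ p - ∑ i ∈ s, x i ^ p) ≤ w p * R ^ p := by
  classical
  induction s using Finset.induction_on with
  | empty =>
    simp only [Finset.sum_empty, zero_pow hp.ne_zero, sub_zero, map_zero]
    exact mul_nonneg (apply_nonneg w _) (by positivity)
  | insert i s his ih =>
    rw [Finset.sum_insert his, Finset.sum_insert his]
    have h1 := finitePlace_add_pow_sub_le w hp (hx i (by simp))
      (finitePlace_sum_le w s x hR fun j hj ↦ hx j (by simp [hj]))
    have h2 := ih fun j hj ↦ hx j (by simp [hj])
    have : (x i + ∑ j ∈ s, x j) ^ p - (x i ^ p + ∑ j ∈ s, x j ^ p) =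
      ((x i + ∑ j ∈ s, x j) ^ p - x i ^ p - (∑ j ∈ s, x j) ^ p) +
        ((∑ j ∈ s, x j) ^ p - ∑ j ∈ s, x j ^ p) := by ring
    rw [this]
    exact (finitePlace_add_le w _ _).trans (max_le h1 h2)

lemma finitePlace_le_sum {ι : Type*} (w : FinitePlace M) (s : Finset ι) (x : ι → M)
    (hx : ∀ i ∈ s, ∀ j ∈ s, i ≠ j → x i ≠ 0 → w (x i) ≠ w (x j)) {i : ι} (hi : i ∈ s) :
    w (x i) ≤ w (∑ j ∈ s, x j) := by
  classical
  obtain ⟨k, hk, hmax⟩ := s.exists_max_image (fun j ↦ w (x j)) ⟨i, hi⟩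
  rcases eq_or_ne (x k) 0 with h0 | h0
  · refine (hmax i hi).trans ?_
    rw [h0, map_zero]
    exact apply_nonneg w _
  have hlt : ∀ j ∈ s, j ≠ k → w (x j) < w (x k) := fun j hj hjk ↦
    lt_of_le_of_ne (hmax j hj) (hx k hk j hj hjk.symm h0).symm
  have hna : IsNonarchimedean (w : M → ℝ) := fun x y ↦ finitePlace_add_le w x y
  rw [hna.apply_sum_eq_of_lt (fun a ↦ (map_neg_eq_map w a).symm) hk hlt]
  exact hmax i hi

variable {K : Type*} [Field K] [Algebra K M] {w : FinitePlace M} {p : ℕ}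

/-- The hypothesis `hV` encodes ramification prime to `p` in `K`. If two nonzero terms of indices `i
≠ j` had the same value, `hV` applied to `c i / c j` would give `p ∣ j - i`, impossible for indices
below `p`. So the nonzero terms have distinct values and the sum takes the largest. -/
lemma finitePlace_term_le (hp : p.Prime)
    (hV : ∀ c : K, c ≠ 0 → ∀ j : ℤ, w (algebraMap K M c) ^ p = w p ^ j → (p : ℤ) ∣ j)
    {β : M} (hβ : w β ^ p = w p) (c : ℕ → K) {k : ℕ} (hk : k < p) :
    w (algebraMap K M (c k) * β ^ k) ≤
      w (∑ i ∈ Finset.range p, algebraMap K M (c i) * β ^ i) := by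
  have hp0 : w (p : M) ≠ 0 := by
    have : (p : M) ≠ 0 := by exact_mod_cast hp.ne_zero
    simpa using this
  have hβ0 : w β ≠ 0 := by
    rintro h
    rw [h, zero_pow hp.ne_zero] at hβ
    exact hp0 hβ.symm
  refine finitePlace_le_sum w _ (fun i ↦ algebraMap K M (c i) * β ^ i) ?_
    (Finset.mem_range.mpr hk)
  intro i hi j hj hij hi0 heq
  rw [Finset.mem_range] at hi hj
  have hci : c i ≠ 0 := by rintro h; simp [h] at hi0
  have hj0 : algebraMap K M (c j) * β ^ j ≠ 0 := by
    intro h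
    rw [h, map_zero, map_eq_zero] at heq
    exact hi0 heq
  have hcj : c j ≠ 0 := by rintro h; simp [h] at hj0
  have hwj : w (algebraMap K M (c j)) ≠ 0 := by simpa using hcj
  have key : w (algebraMap K M (c i / c j)) ^ p = w p ^ ((j : ℤ) - i) := by
    have h := congrArg (· ^ p) heq
    simp only [map_mul, map_pow, mul_pow] at h
    rw [← pow_mul, ← pow_mul, mul_comm i, mul_comm j, pow_mul, pow_mul, hβ] at h
    rw [map_div₀, map_div₀, div_pow, zpow_sub₀ hp0, zpow_natCast, zpow_natCast,
      div_eq_div_iff (pow_ne_zero _ hwj) (pow_ne_zero _ hp0), h, mul_comm]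
  have hd := hV _ (div_ne_zero hci hcj) _ key
  have h0 : (j : ℤ) - i = 0 := Int.eq_zero_of_abs_lt_dvd hd (by rw [abs_lt]; omega)
  omega

lemma eq_zero_of_sum_eq_zero (hp : p.Prime)
    (hV : ∀ c : K, c ≠ 0 → ∀ j : ℤ, w (algebraMap K M c) ^ p = w p ^ j → (p : ℤ) ∣ j)
    {β : M} (hβ : w β ^ p = w p) (c : ℕ → K)
    (h : ∑ i ∈ Finset.range p, algebraMap K M (c i) * β ^ i = 0) {k : ℕ} (hk : k < p) :
    c k = 0 := by
  have h1 := finitePlace_term_le hp hV hβ c hk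
  rw [h, map_zero] at h1
  have h2 := le_antisymm h1 (apply_nonneg w _)
  rw [map_eq_zero, mul_eq_zero, map_eq_zero] at h2
  refine h2.resolve_right fun h3 ↦ ?_
  rw [eq_zero_of_pow_eq_zero h3, map_zero, zero_pow hp.ne_zero, eq_comm, map_eq_zero] at hβ
  exact hp.ne_zero (by exact_mod_cast hβ)

/-- No term exceeds the sum in absolute value, so the sum itself serves as the radius `R` in
`finitePlace_sum_pow_sub_le`. -/
lemma finitePlace_pow_sub_le (hp : p.Prime)
    (hV : ∀ c : K, c ≠ 0 → ∀ j : ℤ, w (algebraMap K M c) ^ p = w p ^ j → (p : ℤ) ∣ j)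
    {β u : M} (hβ : w β ^ p = w p) (hu : β ^ p = u) (c : ℕ → K) :
    w ((∑ i ∈ Finset.range p, algebraMap K M (c i) * β ^ i) ^ p -
      ∑ i ∈ Finset.range p, algebraMap K M (c i) ^ p * u ^ i) ≤
      w p * w (∑ i ∈ Finset.range p, algebraMap K M (c i) * β ^ i) ^ p := by
  have h := finitePlace_sum_pow_sub_le w hp (Finset.range p)
    (fun i ↦ algebraMap K M (c i) * β ^ i) (apply_nonneg w _)
    fun i hi ↦ finitePlace_term_le hp hV hβ c (Finset.mem_range.mp hi)
  refine le_trans (le_of_eq ?_) h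
  congr 2
  refine Finset.sum_congr rfl fun i _ ↦ ?_
  rw [mul_pow, ← pow_mul, mul_comm i, pow_mul, hu]

/-- Two conjugates over a field whose ramification index at `w ∣ p` is prime to `p` have congruent
`p`-th powers. -/
lemma finitePlace_pow_sub_pow_le (hp : p.Prime)
    (hV : ∀ c : K, c ≠ 0 → ∀ j : ℤ, w (algebraMap K M c) ^ p = w p ^ j → (p : ℤ) ∣ j)
    {β β' : M} (hβ : w β ^ p = w p) (hβ' : β' ^ p = β ^ p) (c : ℕ → K) {a a' : M}
    (ha : a = ∑ i ∈ Finset.range p, algebraMap K M (c i) * β ^ i)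
    (ha' : a' = ∑ i ∈ Finset.range p, algebraMap K M (c i) * β' ^ i) :
    w (a ^ p - a' ^ p) ≤ w p * (max (w a) 1 ^ p * max (w a') 1 ^ p) := by
  have hβw : w β' ^ p = w p := by rw [← map_pow, hβ', map_pow, hβ]
  have h1 := finitePlace_pow_sub_le hp hV hβ rfl c
  have h2 := finitePlace_pow_sub_le hp hV hβw hβ' c
  rw [← ha] at h1
  rw [← ha'] at h2
  -- `C` involves `β` only through `β ^ p`, so it approximates both `a ^ p` and `a' ^ p`.
  set C := ∑ i ∈ Finset.range p, algebraMap K M (c i) ^ p * (β ^ p) ^ i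
  have h3 : w (a ^ p - a' ^ p) ≤ max (w (a ^ p - C)) (w (a' ^ p - C)) := by
    have := finitePlace_add_le w (a ^ p - C) (-(a' ^ p - C))
    rwa [map_neg_eq_map, neg_sub, sub_add_sub_cancel] at this
  have hA : 1 ≤ max (w a) 1 ^ p := one_le_pow₀ (le_max_right _ _)
  have hA' : 1 ≤ max (w a') 1 ^ p := one_le_pow₀ (le_max_right _ _)
  have hwp : 0 ≤ w (p : M) := apply_nonneg w _
  refine h3.trans (max_le (h1.trans ?_) (h2.trans ?_))
  · refine mul_le_mul_of_nonneg_left ?_ hwp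
    calc w a ^ p ≤ max (w a) 1 ^ p := by
          gcongr
          exact le_max_left _ _
      _ ≤ _ := le_mul_of_one_le_right (by positivity) hA'
  · refine mul_le_mul_of_nonneg_left ?_ hwp
    calc w a' ^ p ≤ max (w a') 1 ^ p := by
          gcongr
          exact le_max_left _ _
      _ ≤ _ := le_mul_of_one_le_left (by positivity) hA

end TotallyRamified

/-! ### Lower bounds for heights from the product formula -/

section ProductFormula

open IsDedekindDomain HeightOneSpectrum

variable {M : Type*} [Field M] [NumberField M]

lemma hasFiniteMulSupport_max_one (x : M) :
    (fun w : FinitePlace M ↦ max (w x) 1).HasFiniteMulSupport := by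
  rcases eq_or_ne x 0 with rfl | hx
  · simp [Function.HasFiniteMulSupport]
  · have := FinitePlace.hasFiniteMulSupport hx
    fun_prop

lemma finprod_finitePlace_natCast {p : ℕ} (hp : p ≠ 0) :
    ∏ᶠ w : FinitePlace M, w (p : M) = ((p : ℝ) ^ finrank ℚ M)⁻¹ := by
  have hp0 : (p : M) ≠ 0 := by exact_mod_cast hp
  rw [FinitePlace.prod_eq_inv_abs_norm hp0]
  have : (p : M) = algebraMap ℚ M p := by simp
  rw [this, Algebra.norm_algebraMap]
  simp

/-- The archimedean triangle inequality costs a factor `2` per embedding: this is the source of `log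
2` in the final bound. -/
lemma prod_infinitePlace_sub_le (x y : M) :
    ∏ v : InfinitePlace M, v (x - y) ^ v.mult ≤
      2 ^ finrank ℚ M * ((∏ v : InfinitePlace M, max (v x) 1 ^ v.mult) *
        ∏ v : InfinitePlace M, max (v y) 1 ^ v.mult) := by
  rw [← InfinitePlace.sum_mult_eq, ← Finset.prod_pow_eq_pow_sum, ← Finset.prod_mul_distrib,
    ← Finset.prod_mul_distrib]
  refine Finset.prod_le_prod (fun v _ ↦ pow_nonneg (apply_nonneg v _) _) fun v _ ↦ ?_
  rw [← mul_pow, ← mul_pow]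
  refine pow_le_pow_left₀ (apply_nonneg v _) ?_ _
  have h1 : v (x - y) ≤ v x + v y := by
    have := v.1.add_le x (-y)
    rwa [AbsoluteValue.map_neg, ← sub_eq_add_neg] at this
  have hx := le_max_left (v x) 1
  have hx' := le_max_right (v x) 1
  have hy := le_max_left (v y) 1
  have hy' := le_max_right (v y) 1
  nlinarith [mul_nonneg (sub_nonneg.mpr hx') (sub_nonneg.mpr hy')]

lemma finitePlace_sub_le (w : FinitePlace M) (x y : M) :
    w (x - y) ≤ max (w x) 1 * max (w y) 1 := by
  have h := finitePlace_add_le w x (-y)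
  rw [map_neg_eq_map, ← sub_eq_add_neg] at h
  refine h.trans (max_le ?_ ?_)
  · exact (le_max_left _ _).trans (le_mul_of_one_le_right (by positivity) (le_max_right _ _))
  · exact (le_max_left _ _).trans (le_mul_of_one_le_left (by positivity) (le_max_right _ _))

/-- If two elements are congruent modulo `p` at all places above `p`, then the product formula
bounds their heights from below. -/
lemma log_le_of_finitePlace_sub_le {p : ℕ} (hp : p ≠ 0) {x y : M} (hxy : x ≠ y)
    (h : ∀ w : FinitePlace M, w p < 1 → w (x - y) ≤ w p * (max (w x) 1 * max (w y) 1)) :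
    finrank ℚ M * (Real.log p - Real.log 2) ≤ logHeight₁ x + logHeight₁ y := by
  have hp0 : (p : M) ≠ 0 := by exact_mod_cast hp
  have hall : ∀ w : FinitePlace M, w (x - y) ≤ w p * (max (w x) 1 * max (w y) 1) := by
    intro w
    rcases (finitePlace_natCast_le_one w p).lt_or_eq with hlt | heq
    · exact h w hlt
    · rw [heq, one_mul]
      exact finitePlace_sub_le w x y
  have hsub : x - y ≠ 0 := sub_ne_zero.mpr hxy
  have sx := hasFiniteMulSupport_max_one x
  have sy := hasFiniteMulSupport_max_one y
  have sp := FinitePlace.hasFiniteMulSupport hp0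
  have sxy : (fun w : FinitePlace M ↦ max (w x) 1 * max (w y) 1).HasFiniteMulSupport := sx.mul sy
  have hfin : ∏ᶠ w : FinitePlace M, w (x - y) ≤ ((p : ℝ) ^ finrank ℚ M)⁻¹ *
      ((∏ᶠ w : FinitePlace M, max (w x) 1) * ∏ᶠ w : FinitePlace M, max (w y) 1) := by
    rw [← finprod_finitePlace_natCast hp, ← finprod_mul_distrib sx sy,
      ← finprod_mul_distrib sp sxy]
    exact finprod_le_finprod (FinitePlace.hasFiniteMulSupport hsub) (fun w ↦ apply_nonneg w _)
      (sp.mul sxy) hall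
  have hinf := prod_infinitePlace_sub_le x y
  have hpf := prod_abs_eq_one hsub
  have hfin0 : 0 ≤ ∏ᶠ w : FinitePlace M, w (x - y) := finprod_nonneg fun w ↦ apply_nonneg w _
  have hprod := mul_le_mul hinf hfin hfin0 (by positivity)
  have hH : mulHeight₁ x * mulHeight₁ y * (2 ^ finrank ℚ M * ((p : ℝ) ^ finrank ℚ M)⁻¹) =
      2 ^ finrank ℚ M * ((∏ v : InfinitePlace M, max (v x) 1 ^ v.mult) *
        ∏ v : InfinitePlace M, max (v y) 1 ^ v.mult) * (((p : ℝ) ^ finrank ℚ M)⁻¹ *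
      ((∏ᶠ w : FinitePlace M, max (w x) 1) * ∏ᶠ w : FinitePlace M, max (w y) 1)) := by
    rw [NumberField.mulHeight₁_eq, NumberField.mulHeight₁_eq]
    ring
  rw [hpf, ← hH] at hprod
  have hpR : (0 : ℝ) < p := by exact_mod_cast hp.bot_lt
  have hlog := Real.log_le_log one_pos hprod
  rw [Real.log_one, Real.log_mul (mul_pos (mulHeight₁_pos _) (mulHeight₁_pos _)).ne' (by positivity),
    Real.log_mul (mulHeight₁_ne_zero _) (mulHeight₁_ne_zero _), Real.log_mul (by positivity)
    (by positivity), Real.log_inv, Real.log_pow, Real.log_pow, ← logHeight₁_eq_log_mulHeight₁,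
    ← logHeight₁_eq_log_mulHeight₁] at hlog
  linarith

/-- The value is a positive integral power of the norm of the prime `P` below `u`, and `p` divides
that norm: otherwise `P` would contain two coprime integers. -/
lemma le_finitePlace_of_one_lt {p : ℕ} (hp : p.Prime) (u : FinitePlace M) (hu : u p < 1) {b : M}
    (hb : 1 < u b) : (p : ℝ) ≤ u b := by
  let P := u.maximalIdeal
  have hb0 : b ≠ 0 := by rintro rfl; rw [map_zero] at hb; linarith
  have hpP : ((p : ℕ) : 𝓞 M) ∈ P.asIdeal := by
    rw [finitePlace_lt_one_iff] at hu
    rw [← valuation_lt_one_iff_mem (K := M)]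
    simpa using hu
  have hN : p ≤ Ideal.absNorm P.asIdeal := by
    have hN0 : 0 < Ideal.absNorm P.asIdeal := (one_lt_absNorm P).pos
    refine Nat.le_of_dvd hN0 ?_
    by_contra hdvd
    have hcop : IsCoprime (p : ℤ) (Ideal.absNorm P.asIdeal : ℤ) :=
      Nat.isCoprime_iff_coprime.mpr ((Nat.Prime.coprime_iff_not_dvd hp).mpr hdvd)
    obtain ⟨s, t, hst⟩ := hcop
    apply P.isPrime.ne_top
    rw [Ideal.eq_top_iff_one]
    have h1 : ((s * p + t * (Ideal.absNorm P.asIdeal : ℤ) : ℤ) : 𝓞 M) ∈ P.asIdeal := by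
      push_cast
      exact P.asIdeal.add_mem (P.asIdeal.mul_mem_left _ hpP)
        (P.asIdeal.mul_mem_left _ (Ideal.absNorm_mem _))
    rwa [hst, Int.cast_one] at h1
  have hv : P.valuation M b ≠ 0 := (P.valuation M).ne_zero_iff.mpr hb0
  have hub : u b = (Ideal.absNorm P.asIdeal : ℝ) ^ (WithZero.unzero hv).toAdd := by
    rw [finitePlace_eq_toNNReal, WithZeroMulInt.toNNReal_neg_apply _ hv]
    push_cast
    rfl
  rw [hub] at hb ⊢
  have hN1 : (1 : ℝ) < Ideal.absNorm P.asIdeal := by exact_mod_cast one_lt_absNorm P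
  have hk := (one_lt_zpow_iff_right₀ hN1).mp hb
  calc (p : ℝ) ≤ (Ideal.absNorm P.asIdeal : ℝ) ^ (1 : ℤ) := by
        rw [zpow_one]
        exact_mod_cast hN
    _ ≤ _ := zpow_le_zpow_right₀ hN1.le (by omega)

lemma log_finitePlace_le_logHeight₁ (u : FinitePlace M) (b : M) :
    Real.log (u b) ≤ logHeight₁ b := by
  rw [NumberField.logHeight₁_eq]
  have h1 : 0 ≤ ∑ v : InfinitePlace M, v.mult * Real.posLog (v b) :=
    Finset.sum_nonneg fun v _ ↦ mul_nonneg (Nat.cast_nonneg _) Real.posLog_nonneg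
  have hs : (Function.support fun w : FinitePlace M ↦ Real.posLog (w b)).Finite := by
    refine (hasFiniteMulSupport_max_one b).subset fun w hw h ↦ hw ?_
    change max (w b) 1 = 1 at h
    rw [Real.posLog_eq_zero_iff, abs_of_nonneg (apply_nonneg w _)]
    exact max_eq_right_iff.mp h
  have h2 := single_le_finsum u hs fun w ↦ Real.posLog_nonneg
  have h3 : Real.log (u b) ≤ Real.posLog (u b) := le_max_right _ _
  linarith

lemma log_le_logHeight₁_of_finitePlace_ne_one {p : ℕ} (hp : p.Prime) (u : FinitePlace M)
    (hu : u p < 1) {b : M} (hb0 : b ≠ 0) (hb : u b ≠ 1) : Real.log p ≤ logHeight₁ b := by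
  have hpR : (0 : ℝ) < p := by exact_mod_cast hp.pos
  rcases hb.lt_or_gt with hlt | hgt
  · have hpos : 0 < u b := FinitePlace.pos_iff.mpr hb0
    have hgt : 1 < u b⁻¹ := by rw [map_inv₀]; exact (one_lt_inv₀ hpos).mpr hlt
    rw [← logHeight₁_inv]
    exact (Real.log_le_log hpR (le_finitePlace_of_one_lt hp u hu hgt)).trans
      (log_finitePlace_le_logHeight₁ u _)
  · exact (Real.log_le_log hpR (le_finitePlace_of_one_lt hp u hu hgt)).trans
      (log_finitePlace_le_logHeight₁ u _)

end ProductFormula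

instance : Algebra.IsAlgebraic ℚ QBar := AlgebraicClosure.isAlgebraic ℚ

/-! ### Degrees in towers and radical extensions -/

section DegreeLemmas

open Polynomial

lemma exists_polynomial_of_mem_adjoin_root {K L : Type*} [Field K] [Field L] [Algebra K L] {p : ℕ}
    (hp : p ≠ 0) {α : L} {u : K} (hα : α ^ p = algebraMap K L u) {x : L} (hx : x ∈ K⟮α⟯) :
    ∃ P : K[X], P.natDegree < p ∧ aeval α P = x := by
  have hmon : (X ^ p - C u : K[X]).Monic := monic_X_pow_sub_C u hp
  have hroot : aeval α (X ^ p - C u : K[X]) = 0 := by simp [hα]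
  have hint : IsIntegral K α := ⟨_, hmon, hroot⟩
  rw [← mem_toSubalgebra, adjoin_simple_toSubalgebra_of_isAlgebraic hint.isAlgebraic,
    Algebra.adjoin_singleton_eq_range_aeval] at hx
  obtain ⟨Q, rfl⟩ := hx
  refine ⟨Q %ₘ (X ^ p - C u), ?_, ?_⟩
  · have := natDegree_modByMonic_lt Q hmon (by
      intro h
      have := natDegree_X_pow_sub_C (n := p) (r := u)
      rw [h, natDegree_one] at this
      exact hp this.symm)
    rwa [natDegree_X_pow_sub_C] at this
  · exact aeval_modByMonic_eq_self_of_root hroot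

lemma natDegree_minpoly_le_of_le {k L : Type*} [Field k] [Field L] [Algebra k L]
    [Algebra.IsAlgebraic k L] {E F : IntermediateField k L} (h : E ≤ F) (a : L) :
    (minpoly F a).natDegree ≤ (minpoly E a).natDegree := by
  have hint : IsIntegral E a := (Algebra.IsAlgebraic.isAlgebraic (R := k) a).isIntegral.tower_top
  have h1 : aeval a ((minpoly E a).map (inclusion h : E →+* F)) = 0 := by
    rw [aeval_def, eval₂_map]
    exact minpoly.aeval E a
  have h2 := minpoly.min F a ((minpoly.monic hint).map (inclusion h : E →+* F)) h1
  exact (natDegree_le_natDegree h2).trans natDegree_map_le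

/-- As `k(b) ⊆ F`, the degree of `a` over `F` is at most `[k(a) : k(b)]`. Taking `b = 1` bounds the
degree over `F` by the degree over `k`. -/
lemma natDegree_minpoly_mul_finrank_le {k L : Type*} [Field k] [Field L] [Algebra k L]
    [Algebra.IsAlgebraic k L] {F : IntermediateField k L} {a b : L} (hb : b ∈ F)
    (hba : b ∈ k⟮a⟯) : (minpoly F a).natDegree * finrank k k⟮b⟯ ≤ finrank k k⟮a⟯ := by
  have hint : IsIntegral k⟮b⟯ a :=
    (Algebra.IsAlgebraic.isAlgebraic (R := k) a).isIntegral.tower_top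
  have h1 := finrank_mul_finrank k k⟮b⟯ k⟮b⟯⟮a⟯
  have h2 : k⟮b⟯⟮a⟯.restrictScalars k = k⟮a⟯ := by
    rw [adjoin_simple_adjoin_simple]
    refine le_antisymm (adjoin_le_iff.mpr ?_) (adjoin.mono _ _ _ (by simp))
    rintro x (rfl | rfl)
    · exact hba
    · exact mem_adjoin_simple_self k _
  have h3 : finrank k k⟮b⟯⟮a⟯ = finrank k k⟮a⟯ := by
    change finrank k (k⟮b⟯⟮a⟯.restrictScalars k) = _
    rw [h2]
  rw [h3, adjoin.finrank hint] at h1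
  rw [← h1, mul_comm]
  exact Nat.mul_le_mul_left _ (natDegree_minpoly_le_of_le
    (adjoin_simple_le_iff.mpr hb) a)

lemma natDegree_minpoly_eq_of_mem_adjoin {K L : Type*} [Field K] [Field L] [Algebra K L] {p : ℕ}
    (hp : p.Prime) {α : L} (hα : finrank K K⟮α⟯ = p) {a : L} (ha : a ∈ K⟮α⟯)
    (ha' : a ∉ (algebraMap K L).range) : (minpoly K a).natDegree = p := by
  have hfd : FiniteDimensional K K⟮α⟯ := FiniteDimensional.of_finrank_pos (hα ▸ hp.pos)
  have hint : IsIntegral K (⟨a, ha⟩ : K⟮α⟯) := IsIntegral.of_finite K _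
  have h1 : (minpoly K a) = minpoly K (⟨a, ha⟩ : K⟮α⟯) :=
    minpoly.algebraMap_eq (algebraMap K⟮α⟯ L).injective (⟨a, ha⟩ : K⟮α⟯)
  have h2 := minpoly.degree_dvd hint
  rw [hα, ← h1] at h2
  refine ((Nat.dvd_prime hp).mp h2).resolve_left fun h ↦ ha' ?_
  exact minpoly.natDegree_eq_one_iff.mp h

lemma natDegree_minpoly_mul_deg_le {F : IntermediateField ℚ QBar} {a b : QBar} (hb : b ∈ F)
    (hba : b ∈ ℚ⟮a⟯) : (minpoly F a).natDegree * deg b ≤ deg a :=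
  natDegree_minpoly_mul_finrank_le hb hba

end DegreeLemmas

/-! ### The dichotomy for elements of a Kummer extension -/

section KummerStep

open Polynomial

variable {F M : Type*} [Field F] [NumberField F] [Field M] [NumberField M]

lemma exists_finitePlace_natCast_lt_one (M : Type*) [Field M] [NumberField M] {p : ℕ}
    (hp : p.Prime) : ∃ w : FinitePlace M, w p < 1 := by
  by_contra! h
  have h1 : ∏ᶠ w : FinitePlace M, w (p : M) = 1 :=
    finprod_eq_one_of_forall_eq_one fun w ↦ le_antisymm (finitePlace_natCast_le_one w p) (h w)
  rw [finprod_finitePlace_natCast hp.ne_zero, inv_eq_one,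
    pow_eq_one_iff_of_nonneg (Nat.cast_nonneg _) finrank_pos.ne'] at h1
  exact hp.one_lt.ne' (by exact_mod_cast h1)

lemma finitePlace_natCast_eq_one {p q : ℕ} (hpq : p.Coprime q) {w : FinitePlace M}
    (hw : w p < 1) : w (q : M) = 1 := by
  refine le_antisymm (finitePlace_natCast_le_one w q) (le_of_not_gt fun hq ↦ ?_)
  obtain ⟨s, t, hst⟩ := Nat.isCoprime_iff_coprime.mpr hpq
  have hna : IsNonarchimedean (w ·) := FinitePlace.add_le w
  have hint (n : ℤ) : w (n : M) ≤ 1 := IsNonarchimedean.apply_intCast_le_one hna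
  have h1 : (s : M) * p + t * q = 1 := by exact_mod_cast congrArg (Int.cast : ℤ → M) hst
  have h2 := finitePlace_add_le w (s * p) (t * q)
  rw [h1, map_one, map_mul, map_mul] at h2
  refine absurd h2 (not_le.mpr (max_lt ?_ ?_))
  · exact (mul_le_of_le_one_left (apply_nonneg w _) (hint s)).trans_lt hw
  · exact (mul_le_of_le_one_left (apply_nonneg w _) (hint t)).trans_lt hq

lemma finitePlace_pow_eq {p q : ℕ} (hpq : p.Coprime q) {w : FinitePlace M} (hw : w p < 1) {α : M}
    (hα : α ^ p = p / q) : w α ^ p = w p := by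
  rw [← map_pow, hα, map_div₀, finitePlace_natCast_eq_one hpq hw, div_one]

variable [Algebra F M]

lemma dvd_of_finitePlace_algebraMap_pow_eq [IsGalois ℚ F] {p : ℕ} (hp : p.Prime)
    (hF : ¬ p ∣ finrank ℚ F) {w : FinitePlace M} (hw : w p < 1) (c : F) (hc : c ≠ 0) (j : ℤ)
    (h : w (algebraMap F M c) ^ p = w p ^ j) : (p : ℤ) ∣ j := by
  obtain ⟨u, hu⟩ := exists_finitePlace_below (K := F) w
  have hup : u (p : F) < 1 := by
    rw [← (hu _).2, map_natCast]
    exact hw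
  have hp0 : u (p : F) ≠ 0 := by
    have : (p : F) ≠ 0 := by exact_mod_cast hp.ne_zero
    simpa using this
  have hwp0 : w (p : M) ≠ 0 := by
    have : (p : M) ≠ 0 := by exact_mod_cast hp.ne_zero
    simpa using this
  refine dvd_of_finitePlace_pow_eq hp hF u hup hc ?_
  -- Restriction of places only compares values with `1`, so the equation is turned into one of that
  -- form.
  have h1 : u (c ^ p / p ^ j) = 1 := by
    rw [← (hu _).1, map_div₀, map_pow, map_zpow₀, map_natCast, map_div₀, map_pow, map_zpow₀, h,
      div_self (zpow_ne_zero _ hwp0)]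
  rwa [map_div₀, map_pow, map_zpow₀, div_eq_one_iff_eq (zpow_ne_zero _ hp0)] at h1

/-- An Eisenstein-type argument: a minimal polynomial of degree below `p` would be a vanishing
combination of `1, α, …, α^(p-1)`, so its leading coefficient would be `0`. -/
lemma natDegree_minpoly_eq_prime [IsGalois ℚ F] {p q : ℕ} (hp : p.Prime) (hpq : p.Coprime q)
    (hF : ¬ p ∣ finrank ℚ F) {α : M} (hα : α ^ p = p / q) :
    minpoly F α = X ^ p - C ((p : F) / q) := by
  have hmon : (X ^ p - C ((p : F) / q)).Monic := monic_X_pow_sub_C _ hp.ne_zero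
  have hroot : aeval α (X ^ p - C ((p : F) / q)) = 0 := by simp [hα]
  have hint : IsIntegral F α := ⟨_, hmon, hroot⟩
  refine (eq_of_monic_of_dvd_of_natDegree_le (minpoly.monic hint) hmon
    (minpoly.dvd F α hroot) ?_).symm
  rw [natDegree_X_pow_sub_C]
  by_contra! hlt
  obtain ⟨w, hw⟩ := exists_finitePlace_natCast_lt_one M hp
  have hz := eq_zero_of_sum_eq_zero hp (dvd_of_finitePlace_algebraMap_pow_eq (M := M) hp hF hw)
    (finitePlace_pow_eq hpq hw hα) (minpoly F α).coeff
    (by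
      have h := minpoly.aeval F α
      rw [aeval_eq_sum_range' hlt] at h
      simpa only [Algebra.smul_def] using h)
    (k := (minpoly F α).natDegree) hlt
  rw [coeff_natDegree, (minpoly.monic hint).leadingCoeff] at hz
  exact one_ne_zero hz

/-- An element of a Kummer extension of prime degree generated by a `p`-th root of a `p`-adic
uniformizer is either of large height, or it is a `p`-th root of an element of the base. -/
lemma log_sub_log_le_or [IsGalois ℚ F] {p q : ℕ} (hp : p.Prime) (hpq : p.Coprime q)
    (hF : ¬ p ∣ finrank ℚ F) {ζ : F} (hζ : IsPrimitiveRoot ζ p) {α : M} (hα : α ^ p = p / q)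
    (htop : F⟮α⟯ = ⊤) (a : M) (ha : a ∉ (algebraMap F M).range) :
    finrank ℚ M * (Real.log p - Real.log 2) ≤ 2 * p * logHeight₁ a ∨
      ∃ (c : F) (m : ℕ), c ≠ 0 ∧ 0 < m ∧ m < p ∧ a = algebraMap F M c * α ^ m := by
  have hu : α ^ p = algebraMap F M (p / q) := by simpa using hα
  have hmin := natDegree_minpoly_eq_prime (F := F) hp hpq hF hα
  have hζM : IsPrimitiveRoot (algebraMap F M ζ) p := hζ.map_of_injective (algebraMap F M).injective
  obtain ⟨P, hPd, rfl⟩ := exists_polynomial_of_mem_adjoin_root hp.ne_zero hu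
    (show a ∈ F⟮α⟯ by rw [htop]; trivial)
  have hint : IsIntegral F α := IsIntegral.of_finite F α
  have hgen : Algebra.adjoin F {α} = ⊤ := by
    rw [← adjoin_simple_toSubalgebra_of_isAlgebraic hint.isAlgebraic, htop, top_toSubalgebra]
  let pb : PowerBasis F M := PowerBasis.ofAdjoinEqTop hint hgen
  have hpb : pb.gen = α := PowerBasis.ofAdjoinEqTop_gen hint hgen
  have hβ : (algebraMap F M ζ * α) ^ p = α ^ p := by rw [mul_pow, hζM.pow_eq_one, one_mul]
  let σ : M →ₐ[F] M := pb.lift (algebraMap F M ζ * α) (by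
    rw [hpb, hmin]
    simp [hβ, hα])
  have hσ : σ α = algebraMap F M ζ * α := by
    conv_lhs => rw [← hpb]
    exact pb.lift_gen _ _
  have hsum (x : M) : aeval x P = ∑ i ∈ Finset.range p, algebraMap F M (P.coeff i) * x ^ i := by
    rw [aeval_eq_sum_range' hPd]
    simp only [Algebra.smul_def]
  have hσa : σ (aeval α P) = aeval (algebraMap F M ζ * α) P := by
    rw [← aeval_algHom_apply, hσ]
  have hp0 : (0 : ℝ) < finrank ℚ M := by exact_mod_cast finrank_pos
  have hheight : logHeight₁ (σ (aeval α P)) = logHeight₁ (aeval α P) := by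
    have := logHeight₁_map (σ : M →+* M) (aeval α P)
    exact mul_left_cancel₀ hp0.ne' this
  by_cases hne : aeval α P ^ p = σ (aeval α P) ^ p
  · right
    have ha0 : aeval α P ≠ 0 := by
      intro h
      rw [h] at ha
      exact ha ⟨0, map_zero _⟩
    have h1 : (σ (aeval α P) / aeval α P) ^ p = 1 := by
      rw [div_pow, ← hne, div_self (pow_ne_zero _ ha0)]
    have : NeZero p := ⟨hp.ne_zero⟩
    obtain ⟨m, hm, hmeq⟩ := hζM.eq_pow_of_pow_eq_one h1
    have h2 : σ (aeval α P) = algebraMap F M ζ ^ m * aeval α P := by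
      rw [hmeq, div_mul_cancel₀ _ ha0]
    obtain ⟨w, hw⟩ := exists_finitePlace_natCast_lt_one M hp
    -- Compare coefficients of powers of `α` in `σ(a) = ζ^m a`; only the index `m` survives, since
    -- `ζ` is primitive.
    have h3 (i : ℕ) (hi : i < p) : P.coeff i * (ζ ^ i - ζ ^ m) = 0 := by
      refine eq_zero_of_sum_eq_zero hp (dvd_of_finitePlace_algebraMap_pow_eq (M := M) hp hF hw)
        (finitePlace_pow_eq hpq hw hα) (fun i ↦ P.coeff i * (ζ ^ i - ζ ^ m)) ?_ hi
      rw [hσa, hsum, hsum, Finset.mul_sum, ← sub_eq_zero, ← Finset.sum_sub_distrib] at h2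
      rw [← h2]
      refine Finset.sum_congr rfl fun i _ ↦ ?_
      simp only [map_mul, map_sub, map_pow]
      ring
    have h4 : aeval α P = algebraMap F M (P.coeff m) * α ^ m := by
      rw [hsum]
      refine Finset.sum_eq_single_of_mem m (Finset.mem_range.mpr hm) fun i hi him ↦ ?_
      have h5 := (mul_eq_zero.mp (h3 i (Finset.mem_range.mp hi))).resolve_right fun h6 ↦
        him (hζ.pow_inj (Finset.mem_range.mp hi) hm (sub_eq_zero.mp h6))
      rw [h5, map_zero, zero_mul]
    refine ⟨P.coeff m, m, ?_, Nat.pos_of_ne_zero ?_, hm, h4⟩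
    · intro h
      rw [h, map_zero, zero_mul] at h4
      exact ha0 h4
    · rintro rfl
      exact ha ⟨P.coeff 0, by rw [h4, pow_zero, mul_one]⟩
  · left
    have hmax (w : FinitePlace M) (x : M) : max (w x) 1 ^ p ≤ max (w (x ^ p)) 1 := by
      rw [map_pow]
      rcases le_total (w x) 1 with h | h
      · rw [max_eq_right h, one_pow]
        exact le_max_right _ _
      · rw [max_eq_left h]
        exact le_max_left _ _
    -- Applied to `a^p` and `σ(a)^p`, each of height `p` times that of `a`; hence the factor `2 p`.
    have key := log_le_of_finitePlace_sub_le hp.ne_zero hne fun w hw ↦ by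
      refine (finitePlace_pow_sub_pow_le hp
        (dvd_of_finitePlace_algebraMap_pow_eq (M := M) hp hF hw)
        (finitePlace_pow_eq hpq hw hα) hβ P.coeff (hsum α) (hσa.trans (hsum _))).trans ?_
      refine mul_le_mul_of_nonneg_left ?_ (apply_nonneg w _)
      exact mul_le_mul (hmax w _) (hmax w _) (by positivity) (by positivity)
    rw [logHeight₁_pow, logHeight₁_pow, hheight] at key
    linarith

end KummerStep

/-! ### The weighted height bound inside the algebraic closure -/

section LowerBound

lemma adjoin_gen_eq_top {K L : Type*} [Field K] [Field L] [Algebra K L] (α : L) :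
    K⟮AdjoinSimple.gen K α⟯ = ⊤ := by
  apply map_injective K⟮α⟯.val
  rw [adjoin_map, Set.image_singleton, ← AlgHom.fieldRange_eq_map, fieldRange_val]
  rfl

lemma natDegree_minpoly_eq_prime_of_pow_eq {F : IntermediateField ℚ QBar}
    [FiniteDimensional ℚ F] [IsGalois ℚ F] {p q : ℕ} (hp : p.Prime) (hpq : p.Coprime q)
    (hF : ¬ p ∣ finrank ℚ F) {α : QBar} (hα : α ^ p = p / q) :
    (minpoly F α).natDegree = p := by
  have : NumberField F := {}
  have hintα : IsIntegral F α :=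
    (Algebra.IsAlgebraic.isAlgebraic (R := ℚ) α).isIntegral.tower_top
  have : FiniteDimensional F F⟮α⟯ := adjoin.finiteDimensional hintα
  have : FiniteDimensional ℚ F⟮α⟯ := FiniteDimensional.trans ℚ F F⟮α⟯
  have : NumberField F⟮α⟯ := {}
  let α' : F⟮α⟯ := AdjoinSimple.gen F α
  have hα' : α' ^ p = (p : F⟮α⟯) / q := by
    apply (algebraMap F⟮α⟯ QBar).injective
    rw [map_pow, map_div₀, map_natCast, map_natCast]
    exact hα
  have h1 : minpoly F α = minpoly F α' := minpoly.algebraMap_eq (algebraMap F⟮α⟯ QBar).injective α'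
  rw [h1, natDegree_minpoly_eq_prime (F := F) hp hpq hF hα', Polynomial.natDegree_X_pow_sub_C]

/-- The height of an element which generates a Kummer extension of degree `p` of a Galois number
field of degree prime to `p`, obtained by adjoining a `p`-th root of a uniformizer at `p`. -/
theorem log_sub_log_le_deg_mul_absLogHeight₁ {F : IntermediateField ℚ QBar}
    [FiniteDimensional ℚ F] [IsGalois ℚ F] {p q : ℕ} (hp : p.Prime) (hpq : p.Coprime q)
    (hF : ¬ p ∣ finrank ℚ F) {ζ : QBar} (hζF : ζ ∈ F) (hζ : IsPrimitiveRoot ζ p) {α : QBar}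
    (hα : α ^ p = p / q) {a : QBar} (ha : a ∈ F⟮α⟯) (ha' : a ∉ F) :
    (Real.log p - Real.log 2) / 2 ≤ deg a * absLogHeight₁ a := by
  have : NumberField F := {}
  have hintα : IsIntegral F α :=
    (Algebra.IsAlgebraic.isAlgebraic (R := ℚ) α).isIntegral.tower_top
  have : FiniteDimensional F F⟮α⟯ := adjoin.finiteDimensional hintα
  have : FiniteDimensional ℚ F⟮α⟯ := FiniteDimensional.trans ℚ F F⟮α⟯
  have : NumberField F⟮α⟯ := {}
  let α' : F⟮α⟯ := AdjoinSimple.gen F α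
  let ζ' : F := ⟨ζ, hζF⟩
  let a' : F⟮α⟯ := ⟨a, ha⟩
  have hζ' : IsPrimitiveRoot ζ' p :=
    IsPrimitiveRoot.of_map_of_injective (f := algebraMap F QBar) hζ (algebraMap F QBar).injective
  have hα' : α' ^ p = (p : F⟮α⟯) / q := by
    apply (algebraMap F⟮α⟯ QBar).injective
    rw [map_pow, map_div₀, map_natCast, map_natCast]
    exact hα
  have ha'' : a' ∉ (algebraMap F F⟮α⟯).range := by
    rintro ⟨x, hx⟩
    apply ha'
    have : (x : QBar) = a := congrArg (algebraMap F⟮α⟯ QBar) hx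
    exact this ▸ x.2
  have haR : a ∉ (algebraMap F QBar).range := by
    rintro ⟨x, rfl⟩
    exact ha' x.2
  have hfin : finrank F F⟮α⟯ = p := by
    rw [adjoin.finrank hintα, natDegree_minpoly_eq_prime_of_pow_eq hp hpq hF hα]
  have hdeg : (minpoly F a).natDegree = p := natDegree_minpoly_eq_of_mem_adjoin hp hfin ha haR
  have hpR : (0 : ℝ) < p := by exact_mod_cast hp.pos
  have hlogp : Real.log 2 ≤ Real.log p := Real.log_le_log two_pos (by exact_mod_cast hp.two_le)
  have hlog2 : 0 ≤ Real.log 2 := Real.log_nonneg one_le_two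
  have hah := absLogHeight₁_nonneg a
  have hM := finrank_mul_absLogHeight₁ (algebraMap F⟮α⟯ QBar) a'
  have hMa : algebraMap F⟮α⟯ QBar a' = a := rfl
  rw [hMa] at hM
  have hn : (0 : ℝ) < finrank ℚ F⟮α⟯ := by exact_mod_cast finrank_pos
  rcases log_sub_log_le_or hp hpq hF hζ' hα' (adjoin_gen_eq_top α) a' ha'' with
    h | ⟨c, m, hc, hm0, hmp, hac⟩
  · rw [← hM] at h
    have h1 : Real.log p - Real.log 2 ≤ 2 * p * absLogHeight₁ a := by
      refine le_of_mul_le_mul_left ?_ hn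
      linarith
    have h2 : (p : ℝ) ≤ deg a := by
      have := natDegree_minpoly_mul_deg_le (F := F) (a := a) (b := 1) F.one_mem ℚ⟮a⟯.one_mem
      rw [hdeg] at this
      exact_mod_cast (Nat.le_mul_of_pos_right p (deg_pos 1)).trans this
    have h3 := mul_le_mul_of_nonneg_right h2 hah
    linarith
  · have hb : a ^ p ∈ F := by
      have h1 : a' ^ p = algebraMap F F⟮α⟯ (c ^ p * ((p : F) / (q : F)) ^ m) := by
        rw [hac, mul_pow, ← pow_mul, mul_comm m, pow_mul, hα']
        simp
      have h2 : a ^ p = algebraMap F QBar (c ^ p * ((p : F) / (q : F)) ^ m) :=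
        congrArg (algebraMap F⟮α⟯ QBar) h1
      rw [h2]
      exact SetLike.coe_mem (c ^ p * ((p : F) / (q : F)) ^ m)
    have hintb : IsIntegral ℚ (a ^ p) := (Algebra.IsAlgebraic.isAlgebraic (R := ℚ) _).isIntegral
    have : FiniteDimensional ℚ ℚ⟮a ^ p⟯ := adjoin.finiteDimensional hintb
    have : NumberField ℚ⟮a ^ p⟯ := {}
    let f : ℚ⟮a ^ p⟯ →+* F⟮α⟯ := (algebraMap F F⟮α⟯).comp
      (inclusion (adjoin_simple_le_iff.mpr hb)).toRingHom
    let _ : Algebra ℚ⟮a ^ p⟯ F⟮α⟯ := f.toAlgebra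
    obtain ⟨w, hw⟩ := exists_finitePlace_natCast_lt_one F⟮α⟯ hp
    obtain ⟨u, hu⟩ := exists_finitePlace_below (K := ℚ⟮a ^ p⟯) w
    have ha0 : a ≠ 0 := by
      rintro rfl
      exact ha' F.zero_mem
    have hup : u (p : ℚ⟮a ^ p⟯) < 1 := by
      rw [← (hu _).2, map_natCast]
      exact hw
    have hwp0 : w (p : F⟮α⟯) ≠ 0 := by
      have : (p : F⟮α⟯) ≠ 0 := by exact_mod_cast hp.ne_zero
      simpa using this
    -- Here `a^p = c^p (α^p)^m`, and `α^p` has the same value as `p`. Value `1` would force `p ∣ m`,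
    -- against `0 < m < p`.
    have hub : u (AdjoinSimple.gen ℚ (a ^ p)) ≠ 1 := by
      rw [Ne, ← (hu _).1]
      have h1 : algebraMap ℚ⟮a ^ p⟯ F⟮α⟯ (AdjoinSimple.gen ℚ (a ^ p)) = a' ^ p := rfl
      rw [h1, hac, mul_pow, ← pow_mul, mul_comm m, pow_mul, map_mul, map_pow, map_pow w _ m,
        map_pow w _ p, finitePlace_pow_eq hpq hw hα']
      intro h2
      have h3 := dvd_of_finitePlace_algebraMap_pow_eq (M := F⟮α⟯) hp hF hw c hc (-m) (by
        rw [zpow_neg, zpow_natCast]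
        exact eq_inv_of_mul_eq_one_left h2)
      rw [dvd_neg, Int.natCast_dvd_natCast] at h3
      exact hmp.not_ge (Nat.le_of_dvd hm0 h3)
    have hb0 : AdjoinSimple.gen ℚ (a ^ p) ≠ 0 := by
      intro h
      exact pow_ne_zero p ha0 (congrArg (algebraMap ℚ⟮a ^ p⟯ QBar) h)
    have h4 := log_le_logHeight₁_of_finitePlace_ne_one hp u hup hb0 hub
    rw [← finrank_mul_absLogHeight₁ (algebraMap ℚ⟮a ^ p⟯ QBar), AdjoinSimple.algebraMap_gen,
      absLogHeight₁_pow] at h4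
    have h5 := natDegree_minpoly_mul_deg_le hb (pow_mem (mem_adjoin_simple_self ℚ a) p)
    rw [hdeg] at h5
    have h6 : (p : ℝ) * finrank ℚ ℚ⟮a ^ p⟯ ≤ deg a := by exact_mod_cast h5
    have h7 := mul_le_mul_of_nonneg_right h6 hah
    linarith

end LowerBound

/-! ### Galois fields of degree prime to `p` -/

section GaloisDegree

open Polynomial

/-- An orbit under `σ` has `1` or `p` elements, and that of `x` consists of roots of `g`, of which
there are fewer than `p`. -/
lemma apply_eq_self_of_orderOf_eq_prime {k E : Type*} [Field k] [Field E] [Algebra k E] {p : ℕ}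
    (hp : p.Prime) {σ : E ≃ₐ[k] E} (hσ : orderOf σ = p) {x : E} {g : k[X]} (hg : g ≠ 0)
    (hgp : g.natDegree < p) (hx : aeval x g = 0) : σ x = x := by
  classical
  by_contra hne
  have : Fact p.Prime := ⟨hp⟩
  have hit (n : ℕ) (y : E) : σ^[n] y = (σ ^ n) y := by
    induction n with
    | zero => rfl
    | succ n ih => rw [Function.iterate_succ_apply', ih, pow_succ', AlgEquiv.mul_apply]
  have hper : Function.IsPeriodicPt σ p x := by
    change σ^[p] x = x
    rw [hit, ← hσ, pow_orderOf_eq_one, AlgEquiv.one_apply]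
  have hmin : Function.minimalPeriod σ x = p := Function.minimalPeriod_eq_prime hper hne
  have hinj := Function.iterate_injOn_Iio_minimalPeriod (f := σ) (x := x)
  rw [hmin] at hinj
  have hsub : (Finset.range p).image (fun n ↦ σ^[n] x) ⊆ (g.aroots E).toFinset := by
    intro y hy
    obtain ⟨n, -, rfl⟩ := Finset.mem_image.mp hy
    rw [Multiset.mem_toFinset, mem_aroots]
    refine ⟨hg, ?_⟩
    change aeval (σ^[n] x) g = 0
    rw [hit]
    change aeval ((σ ^ n : E ≃ₐ[k] E).toAlgHom x) g = 0
    rw [aeval_algHom_apply, hx, map_zero]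
  have hcard := Finset.card_le_card hsub
  rw [Finset.card_image_of_injOn (by
    intro i hi j hj h
    exact hinj (by simpa using hi) (by simpa using hj) h), Finset.card_range] at hcard
  have h1 := (Multiset.toFinset_card_le (g.aroots E)).trans (card_roots' _)
  have h2 : (g.map (algebraMap k E)).natDegree ≤ g.natDegree := natDegree_map_le
  omega

lemma isGalois_adjoin_rootSet {k L : Type*} [Field k] [CharZero k] [Field L] [Algebra k L]
    [IsAlgClosed L] (f : k[X]) : IsGalois k (adjoin k (f.rootSet L)) := by
  have : f.IsSplittingField k (adjoin k (f.rootSet L)) :=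
    adjoin_rootSet_isSplittingField (IsAlgClosed.splits _)
  have : Normal k (adjoin k (f.rootSet L)) := Normal.of_isSplittingField f
  exact {}

/-- Otherwise Cauchy's theorem yields an automorphism of order `p`, which fixes every generator and
so is trivial. -/
lemma not_dvd_finrank_adjoin_rootSet {k L : Type*} [Field k] [CharZero k] [Field L] [Algebra k L]
    [IsAlgClosed L] {p : ℕ} (hp : p.Prime) (f : k[X])
    (hroot : ∀ x ∈ f.rootSet L, ∃ g : k[X], g ≠ 0 ∧ g.natDegree < p ∧ aeval x g = 0) :
    ¬ p ∣ finrank k (adjoin k (f.rootSet L)) := by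
  intro hdvd
  have hgal := isGalois_adjoin_rootSet (L := L) f
  have hsplit : f.IsSplittingField k (adjoin k (f.rootSet L)) :=
    adjoin_rootSet_isSplittingField (IsAlgClosed.splits _)
  have : FiniteDimensional k (adjoin k (f.rootSet L)) :=
    IsSplittingField.finiteDimensional _ f
  have : Fact p.Prime := ⟨hp⟩
  rw [← IsGalois.card_aut_eq_finrank] at hdvd
  obtain ⟨σ, hσ⟩ := exists_prime_orderOf_dvd_card' p hdvd
  have hσ1 : σ = 1 := by
    have h : (adjoin k (f.rootSet L)).val.comp σ.toAlgHom = (adjoin k (f.rootSet L)).val := by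
      refine algHom_ext_of_eq_adjoin _ rfl fun x hx ↦ ?_
      obtain ⟨g, hg, hgp, hgx⟩ := hroot x hx
      have hx' : aeval (⟨x, subset_adjoin k _ hx⟩ : adjoin k (f.rootSet L)) g = 0 := by
        apply (algebraMap (adjoin k (f.rootSet L)) L).injective
        rw [← aeval_algebraMap_apply, map_zero]
        exact hgx
      exact congrArg Subtype.val (apply_eq_self_of_orderOf_eq_prime hp hσ hg hgp hx')
    ext x
    exact DFunLike.congr_fun h x
  rw [hσ1, orderOf_one] at hσ
  exact hp.one_lt.ne hσ

lemma finiteDimensional_adjoin_rootSet {k L : Type*} [Field k] [Field L] [Algebra k L]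
    [IsAlgClosed L] (f : k[X]) : FiniteDimensional k (adjoin k (f.rootSet L)) :=
  have : f.IsSplittingField k (adjoin k (f.rootSet L)) :=
    adjoin_rootSet_isSplittingField (IsAlgClosed.splits _)
  IsSplittingField.finiteDimensional _ f

end GaloisDegree

/-! ### The tower generated by the radicals -/

section Tower

open Polynomial

/-- Write `a = P(α)` with `P` over `E` of degree below `p`. Over `F`, the polynomial `P - a` kills
`α` but has too small a degree, so it is zero and `P` is constant. This turns `a ∉ K_i` into `a ∉ F`
for the enlarged Galois field. -/
lemma mem_of_mem_adjoin_root_of_mem {k L : Type*} [Field k] [Field L] [Algebra k L]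
    {E F : IntermediateField k L} (hEF : E ≤ F) {p : ℕ} (hp : p ≠ 0) {α : L} {u : E}
    (hα : α ^ p = algebraMap E L u) (hmin : (minpoly F α).natDegree = p) {a : L}
    (ha : a ∈ E⟮α⟯) (haF : a ∈ F) : a ∈ E := by
  obtain ⟨P, hP, rfl⟩ := exists_polynomial_of_mem_adjoin_root hp hα ha
  let Q : F[X] := P.map (inclusion hEF : E →+* F) - C ⟨aeval α P, haF⟩
  have hQ : aeval α Q = 0 := by
    rw [map_sub, aeval_C, aeval_def, eval₂_map, sub_eq_zero]
    rfl
  have hQd : Q.natDegree < p := by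
    rw [natDegree_sub_C]
    exact natDegree_map_le.trans_lt hP
  have hQ0 : Q = 0 := by
    by_contra h
    have := natDegree_le_of_dvd (minpoly.dvd F α hQ) h
    omega
  have hd : P.natDegree = 0 := by
    have h1 : P.map (inclusion hEF : E →+* F) = C ⟨aeval α P, haF⟩ := sub_eq_zero.mp hQ0
    rw [← natDegree_map_eq_of_injective (inclusion hEF : E →+* F).injective P, h1, natDegree_C]
  rw [eq_C_of_natDegree_eq_zero hd, aeval_C]
  exact SetLike.coe_mem (P.coeff 0)

lemma adjoin_insert_le {k L : Type*} [Field k] [Field L] [Algebra k L]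
    {E : IntermediateField k L} {S T : Set L} {α : L} (hS : S ⊆ insert α T)
    (hE : T ⊆ E) : adjoin k S ≤ E⟮α⟯.restrictScalars k := by
  refine adjoin_le_iff.mpr fun x hx ↦ ?_
  rcases hS hx with rfl | hx
  · exact mem_adjoin_simple_self E x
  · exact (E⟮α⟯).algebraMap_mem ⟨x, hE hx⟩

lemma exists_mem_adjoin_image_Iio {k L : Type*} [Field k] [Field L] [Algebra k L] (α : ℕ → L)
    {a : L} (ha : a ∈ adjoin k (Set.range α)) : ∃ n, a ∈ adjoin k (α '' Set.Iio n) := by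
  have hmono : Monotone fun n : ℕ ↦ adjoin k (α '' Set.Iio n) := fun m n h ↦
    adjoin.mono _ _ _ (Set.image_mono (Set.Iio_subset_Iio h))
  have hle : adjoin k (Set.range α) ≤ ⨆ n : ℕ, adjoin k (α '' Set.Iio n) := by
    refine adjoin_le_iff.mpr ?_
    rintro _ ⟨j, rfl⟩
    exact le_iSup (fun n : ℕ ↦ adjoin k (α '' Set.Iio n)) (j + 1)
      (subset_adjoin _ _ ⟨j, Nat.lt_succ_self j, rfl⟩)
  have h := hle ha
  rw [← SetLike.mem_coe, coe_iSup_of_directed hmono.directed_le, Set.mem_iUnion] at h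
  exact h

lemma exists_isPrimitiveRoot (n : ℕ) [NeZero n] : ∃ ζ : QBar, IsPrimitiveRoot ζ n := by
  have : NeZero ((n : ℕ) : QBar) := ⟨by exact_mod_cast NeZero.ne n⟩
  obtain ⟨ζ, hζ⟩ := IsAlgClosed.exists_root (cyclotomic n QBar)
    (by rw [degree_cyclotomic]; exact_mod_cast (Nat.totient_pos.mpr (NeZero.pos n)).ne')
  exact ⟨ζ, isRoot_cyclotomic_iff.mp hζ⟩

variable {p q : ℕ → ℕ} {α : ℕ → QBar}

/-- Below the `i`-th step, the tower is contained in a Galois number field which contains the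
`p i`-th roots of unity and has degree prime to `p i`. -/
lemma exists_isGalois_not_dvd_finrank (hp : ∀ i, (p i).Prime) (hmono : StrictMono p)
    (hα : ∀ i, α i ^ p i = (p i : QBar) / q i) (i : ℕ) :
    ∃ F : IntermediateField ℚ QBar, FiniteDimensional ℚ F ∧ IsGalois ℚ F ∧
      ¬ p i ∣ finrank ℚ F ∧ α '' Set.Iio i ⊆ F ∧ ∃ ζ ∈ F, IsPrimitiveRoot ζ (p i) := by
  have : NeZero (p i) := ⟨(hp i).ne_zero⟩
  -- Every factor has degree below `p i`: the cyclotomic one has degree `p i - 1`, the others `p j`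
  -- with `j < i`.
  let f : ℚ[X] := cyclotomic (p i) ℚ * ∏ j ∈ Finset.range i, (X ^ p j - C ((p j : ℚ) / q j))
  have hg (j : ℕ) : (X ^ p j - C ((p j : ℚ) / q j)) ≠ 0 := X_pow_sub_C_ne_zero (hp j).pos _
  have hf : f ≠ 0 := mul_ne_zero (cyclotomic_ne_zero _ _) (Finset.prod_ne_zero_iff.mpr fun j _ ↦ hg j)
  have hgα (j : ℕ) : aeval (α j) (X ^ p j - C ((p j : ℚ) / q j)) = 0 := by simp [hα]
  obtain ⟨ζ, hζ⟩ := exists_isPrimitiveRoot (p i)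
  have hζ0 : aeval ζ (cyclotomic (p i) ℚ) = 0 := by
    have : NeZero ((p i : ℕ) : QBar) := ⟨by exact_mod_cast (hp i).ne_zero⟩
    rw [aeval_def, ← eval_map, map_cyclotomic]
    exact isRoot_cyclotomic_iff.mpr hζ
  refine ⟨adjoin ℚ (f.rootSet QBar), finiteDimensional_adjoin_rootSet f, isGalois_adjoin_rootSet f,
    not_dvd_finrank_adjoin_rootSet (hp i) f fun x hx ↦ ?_, ?_, ζ, subset_adjoin _ _ ?_, hζ⟩
  · have h := aeval_eq_zero_of_mem_rootSet hx
    rw [map_mul, mul_eq_zero, map_prod, Finset.prod_eq_zero_iff] at h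
    rcases h with h | ⟨j, hj, h⟩
    · refine ⟨_, cyclotomic_ne_zero (p i) ℚ, ?_, h⟩
      rw [natDegree_cyclotomic, Nat.totient_prime (hp i)]
      exact Nat.sub_lt (hp i).pos one_pos
    · refine ⟨_, hg j, ?_, h⟩
      rw [natDegree_X_pow_sub_C]
      exact hmono (Finset.mem_range.mp hj)
  · rintro _ ⟨j, hj, rfl⟩
    refine subset_adjoin _ _ ((mem_rootSet_of_ne hf).mpr ?_)
    rw [map_mul, map_prod, Finset.prod_eq_zero (Finset.mem_range.mpr hj) (hgα j), mul_zero]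
  · refine (mem_rootSet_of_ne hf).mpr ?_
    rw [map_mul, hζ0, zero_mul]

lemma le_deg_mul_absLogHeight₁_of_mem_of_notMem (hp : ∀ i, (p i).Prime) (hmono : StrictMono p)
    (hpq : ∀ i, (p i).Coprime (q i)) (hα : ∀ i, α i ^ p i = (p i : QBar) / q i) {i : ℕ} {a : QBar}
    (ha : a ∈ adjoin ℚ (α '' Set.Iio (i + 1))) (ha' : a ∉ adjoin ℚ (α '' Set.Iio i)) :
    (Real.log (p i) - Real.log 2) / 2 ≤ deg a * absLogHeight₁ a := by
  obtain ⟨F, hF1, hF2, hF3, hF4, ζ, hζF, hζ⟩ := exists_isGalois_not_dvd_finrank hp hmono hα i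
  have hins : α '' Set.Iio (i + 1) ⊆ insert (α i) (α '' Set.Iio i) := by
    rintro _ ⟨j, hj, rfl⟩
    rcases (Nat.lt_succ_iff.mp hj).lt_or_eq with h | rfl
    · exact Or.inr ⟨j, h, rfl⟩
    · exact Or.inl rfl
  have hmin := natDegree_minpoly_eq_prime_of_pow_eq (hp i) (hpq i) hF3 (hα i)
  refine log_sub_log_le_deg_mul_absLogHeight₁ (hp i) (hpq i) hF3 hζF hζ (hα i)
    (adjoin_insert_le hins hF4 ha) fun haF ↦ ha' ?_
  refine mem_of_mem_adjoin_root_of_mem (adjoin_le_iff.mpr hF4) (hp i).ne_zero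
    (u := (p i : adjoin ℚ (α '' Set.Iio i)) / (q i : adjoin ℚ (α '' Set.Iio i))) ?_ hmin
    (adjoin_insert_le hins (subset_adjoin _ _) ha) haF
  rw [map_div₀, map_natCast, map_natCast, hα]

lemma deg_eq_of_pow_eq (hp : ∀ i, (p i).Prime) (hmono : StrictMono p)
    (hpq : ∀ i, (p i).Coprime (q i)) (hα : ∀ i, α i ^ p i = (p i : QBar) / q i) (i : ℕ) :
    deg (α i) = p i := by
  obtain ⟨F, hF1, hF2, hF3, -⟩ := exists_isGalois_not_dvd_finrank hp hmono hα i
  have hmin := natDegree_minpoly_eq_prime_of_pow_eq (hp i) (hpq i) hF3 (hα i)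
  refine le_antisymm ?_ ?_
  · have hroot : aeval (α i) (X ^ p i - C ((p i : ℚ) / q i)) = 0 := by simp [hα]
    have hint : IsIntegral ℚ (α i) := (Algebra.IsAlgebraic.isAlgebraic (R := ℚ) _).isIntegral
    have h := natDegree_le_of_dvd (minpoly.dvd ℚ (α i) hroot) (X_pow_sub_C_ne_zero (hp i).pos _)
    rwa [natDegree_X_pow_sub_C, ← adjoin.finrank hint] at h
  · have := natDegree_minpoly_mul_deg_le (F := F) (a := α i) (b := 1) F.one_mem ℚ⟮α i⟯.one_mem
    rw [hmin] at this
    exact (Nat.le_mul_of_pos_right _ (deg_pos 1)).trans this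

lemma finiteDimensional_adjoin_image_Iio (α : ℕ → QBar) (n : ℕ) :
    FiniteDimensional ℚ (adjoin ℚ (α '' Set.Iio n)) := by
  have : Finite (α '' Set.Iio n) := ((Set.finite_Iio n).image α).to_subtype
  exact finiteDimensional_adjoin fun x _ ↦
    (Algebra.IsAlgebraic.isAlgebraic (R := ℚ) x).isIntegral

end Tower

/-! ### The Northcott and Bogomolov sets; existence of the primes -/

section Sequences

open Filter Topology

lemma HasNorthcott.hasBogomolov {γ : ℝ} {A : Set QBar} (h : HasNorthcott γ A) :
    HasBogomolov γ A := by
  refine ⟨1, one_pos, lt_of_le_of_lt (Set.encard_le_encard ?_) (h 1 one_pos)⟩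
  exact fun a ha ↦ ⟨ha.1.1, ha.2⟩

variable {p q : ℕ → ℕ} {α : ℕ → QBar}

lemma hasNorthcott_adjoin_range (hp : ∀ i, (p i).Prime) (hmono : StrictMono p)
    (hpq : ∀ i, (p i).Coprime (q i)) (hα : ∀ i, α i ^ p i = (p i : QBar) / q i) {γ : ℝ}
    (hγ : 1 ≤ γ) : HasNorthcott γ (adjoin ℚ (Set.range α) : Set QBar) := by
  intro C hC
  have hlim : Tendsto (fun i ↦ (Real.log (p i) - Real.log 2) / 2) atTop atTop := by
    have h1 : Tendsto (fun i ↦ Real.log (p i)) atTop atTop :=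
      Real.tendsto_log_atTop.comp (tendsto_natCast_atTop_atTop.comp hmono.tendsto_atTop)
    exact (tendsto_atTop_add_const_right _ (-Real.log 2) h1).atTop_div_const two_pos
  obtain ⟨N, hN⟩ := eventually_atTop.mp (hlim.eventually_ge_atTop C)
  have hfd := finiteDimensional_adjoin_image_Iio α N
  rw [count, Set.encard_lt_top_iff]
  refine (finite_mem_absLogHeight₁_le (adjoin ℚ (α '' Set.Iio N)) C).subset ?_
  rintro a ⟨haL, haC⟩
  have hah := absLogHeight₁_nonneg a
  have hdeg : (1 : ℝ) ≤ deg a := by exact_mod_cast deg_pos a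
  have hle : deg a * absLogHeight₁ a ≤ height γ a := by
    refine mul_le_mul_of_nonneg_right ?_ hah
    calc (deg a : ℝ) = (deg a : ℝ) ^ (1 : ℝ) := (Real.rpow_one _).symm
      _ ≤ _ := Real.rpow_le_rpow_of_exponent_le hdeg hγ
  have hlt := hle.trans_lt haC
  refine ⟨?_, (le_mul_of_one_le_left hah hdeg).trans hlt.le⟩
  by_contra hmem
  have hex := exists_mem_adjoin_image_Iio α haL
  classical
  -- The least level containing `a` exceeds `N`, so `a` first appears when `α (N + n)` is adjoined,
  -- where the lower bound is at least `C`.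
  obtain ⟨n, hn⟩ : ∃ n, Nat.find hex = N + n + 1 := by
    have : N < Nat.find hex := by
      by_contra! hle
      exact hmem (adjoin.mono ℚ _ _ (Set.image_mono (Set.Iio_subset_Iio hle)) (Nat.find_spec hex))
    exact ⟨Nat.find hex - (N + 1), by omega⟩
  have h1 : a ∈ adjoin ℚ (α '' Set.Iio (N + n + 1)) := hn ▸ Nat.find_spec hex
  have h2 : a ∉ adjoin ℚ (α '' Set.Iio (N + n)) := Nat.find_min hex (by omega)
  have h3 := le_deg_mul_absLogHeight₁_of_mem_of_notMem hp hmono hpq hα h1 h2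
  linarith [hN (N + n) (Nat.le_add_right N n)]

lemma height_eq_of_pow_eq (hp : ∀ i, (p i).Prime) (hmono : StrictMono p)
    (hpq : ∀ i, (p i).Coprime (q i)) (hlt : ∀ i, p i < q i)
    (hα : ∀ i, α i ^ p i = (p i : QBar) / q i) (γ : ℝ) (i : ℕ) :
    height γ (α i) = (p i : ℝ) ^ (γ - 1) * Real.log (q i) := by
  have hpR : (0 : ℝ) < p i := by exact_mod_cast (hp i).pos
  have h1 := absLogHeight₁_pow (α i) (p i)
  rw [hα, absLogHeight₁_ratCast_div (hp i).pos (hpq i) (hlt i).le] at h1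
  rw [height, deg_eq_of_pow_eq hp hmono hpq hα, h1, Real.rpow_sub hpR, Real.rpow_one]
  field_simp

lemma not_hasBogomolov_adjoin_range (hp : ∀ i, (p i).Prime) (hmono : StrictMono p)
    (hpq : ∀ i, (p i).Coprime (q i)) (hlt : ∀ i, p i < q i) (hq : ∀ i, q i < 2 * p i)
    (hα : ∀ i, α i ^ p i = (p i : QBar) / q i) {γ : ℝ} (hγ : γ < 1) :
    ¬ HasBogomolov γ (adjoin ℚ (Set.range α) : Set QBar) := by
  rintro ⟨C, hC, hfin⟩
  have hlim : Tendsto (fun i ↦ 2 * (Real.log (p i) / (p i : ℝ) ^ (1 - γ))) atTop (𝓝 0) := by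
    have h1 := (isLittleO_log_rpow_atTop (sub_pos.mpr hγ)).tendsto_div_nhds_zero
    have h2 := h1.comp (tendsto_natCast_atTop_atTop.comp hmono.tendsto_atTop)
    simpa using h2.const_mul 2
  obtain ⟨N, hN⟩ := eventually_atTop.mp (hlim.eventually_lt_const hC)
  have hinj : Function.Injective α := fun i j h ↦ hmono.injective (by
    rw [← deg_eq_of_pow_eq hp hmono hpq hα i, h, deg_eq_of_pow_eq hp hmono hpq hα j])
  rw [count, Set.encard_lt_top_iff] at hfin
  refine ((Set.Ici_infinite N).image hinj.injOn).mono ?_ hfin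
  rintro _ ⟨i, hi, rfl⟩
  refine ⟨⟨subset_adjoin _ _ ⟨i, rfl⟩, ?_⟩, ?_⟩
  · rintro ⟨-, n, hn, hroot⟩
    have hqQ : (q i : QBar) ≠ 0 := by exact_mod_cast ((hp i).pos.trans (hlt i)).ne'
    have h1 : ((p i : QBar) / q i) ^ n = 1 := by rw [← hα, pow_right_comm, hroot, one_pow]
    rw [div_pow, div_eq_one_iff_eq (pow_ne_zero _ hqQ)] at h1
    have h2 : p i ^ n = q i ^ n := by exact_mod_cast h1
    exact (hlt i).ne (Nat.pow_left_injective hn.ne' h2)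
  · rw [height_eq_of_pow_eq hp hmono hpq hlt hα]
    have hpR : (0 : ℝ) < p i := by exact_mod_cast (hp i).pos
    have hqR : (0 : ℝ) < q i := hpR.trans (by exact_mod_cast hlt i)
    -- From `q i < 2 * p i ≤ (p i)^2`.
    have h1 : Real.log (q i) ≤ 2 * Real.log (p i) := by
      have h2 : (q i : ℝ) ≤ (p i : ℝ) ^ 2 := by
        have := (hq i).le.trans (Nat.mul_le_mul_right (p i) (hp i).two_le)
        rw [sq]
        exact_mod_cast this
      have h3 := Real.log_le_log hqR h2
      rwa [Real.log_pow, Nat.cast_ofNat] at h3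
    calc (p i : ℝ) ^ (γ - 1) * Real.log (q i) ≤ (p i : ℝ) ^ (γ - 1) * (2 * Real.log (p i)) := by
          gcongr
      _ = 2 * (Real.log (p i) / (p i : ℝ) ^ (1 - γ)) := by
          rw [← neg_sub 1 γ, Real.rpow_neg hpR.le]
          ring
      _ < C := hN i hi

theorem northcottSet_eq_and_bogomolovSet_eq (hp : ∀ i, (p i).Prime) (hq : ∀ i, (q i).Prime)
    (hmono : StrictMono p) (hlt : ∀ i, p i < q i ∧ q i < 2 * p i)
    (hα : ∀ i, α i ^ p i = (p i : QBar) / q i) :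
    northcottSet (adjoin ℚ (Set.range α) : Set QBar) = Set.Ici 1 ∧
      bogomolovSet (adjoin ℚ (Set.range α) : Set QBar) = Set.Ici 1 := by
  have hpq (i : ℕ) : (p i).Coprime (q i) := (Nat.coprime_primes (hp i) (hq i)).mpr (hlt i).1.ne
  have hN (γ : ℝ) (hγ : 1 ≤ γ) := hasNorthcott_adjoin_range hp hmono hpq hα hγ
  have hB (γ : ℝ) (h : HasBogomolov γ (adjoin ℚ (Set.range α) : Set QBar)) : 1 ≤ γ := by
    by_contra! hγ
    exact not_hasBogomolov_adjoin_range hp hmono hpq (fun i ↦ (hlt i).1) (fun i ↦ (hlt i).2) hα hγ h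
  exact ⟨Set.Subset.antisymm (fun γ h ↦ hB γ h.hasBogomolov) hN,
    Set.Subset.antisymm hB fun γ hγ ↦ (hN γ hγ).hasBogomolov⟩

/-- Bertrand's postulate; the endpoint `2 * n` is excluded because it is composite. -/
lemma exists_prime_between (n : ℕ) (hn : n.Prime) : ∃ m, m.Prime ∧ n < m ∧ m < 2 * n := by
  obtain ⟨m, hm, h1, h2⟩ := Nat.exists_prime_lt_and_le_two_mul n hn.ne_zero
  refine ⟨m, hm, h1, h2.lt_of_ne ?_⟩
  rintro rfl
  exact Nat.not_prime_mul (by decide) hn.one_lt.ne' hm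

lemma exists_prime_sequences : ∃ p q : ℕ → ℕ, (∀ i, (p i).Prime) ∧ (∀ i, (q i).Prime) ∧
    StrictMono p ∧ ∀ i, p i < q i ∧ q i < 2 * p i := by
  choose f hf using fun n : {n : ℕ // n.Prime} ↦ exists_prime_between n.1 n.2
  -- Iterating from `2` makes `q i = p (i + 1)`.
  let s : ℕ → {n : ℕ // n.Prime} := fun i ↦
    Nat.rec ⟨2, Nat.prime_two⟩ (fun _ n ↦ ⟨f n, (hf n).1⟩) i
  exact ⟨fun i ↦ (s i).1, fun i ↦ f (s i), fun i ↦ (s i).2, fun i ↦ (hf (s i)).1,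
    strictMono_nat_of_lt_succ fun i ↦ (hf (s i)).2.1, fun i ↦ (hf (s i)).2⟩

end Sequences

end WeightedHeight

theorem proposition5p1 :
    (∀ (p q : ℕ → ℕ),
      (∀ i, (p i).Prime) → (∀ i, (q i).Prime) → StrictMono p → StrictMono q →
      (∀ i, q i < p (i + 1)) → (∀ i, p i < q i ∧ q i < 2 * p i) →
      ∀ α : ℕ → QBar, (∀ i, α i ^ p i = (p i : QBar) / (q i : QBar)) →
        WeightedHeight.northcottSet
            (IntermediateField.adjoin ℚ (Set.range α) : Set QBar) = Set.Ici (1 : ℝ) ∧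
        WeightedHeight.bogomolovSet
            (IntermediateField.adjoin ℚ (Set.range α) : Set QBar) = Set.Ici (1 : ℝ)) ∧
    (∃ L : IntermediateField ℚ QBar,
      WeightedHeight.northcottSet (L : Set QBar) = Set.Ici (1 : ℝ) ∧
      WeightedHeight.bogomolovSet (L : Set QBar) = Set.Ici (1 : ℝ)) := by
  refine ⟨fun p q hp hq hmono _ _ hlt α hα ↦
    WeightedHeight.northcottSet_eq_and_bogomolovSet_eq hp hq hmono hlt hα, ?_⟩
  obtain ⟨p, q, hp, hq, hmono, hlt⟩ := WeightedHeight.exists_prime_sequences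
  choose α hα using fun i ↦ IsAlgClosed.exists_pow_nat_eq ((p i : QBar) / q i) (hp i).pos
  exact ⟨_, WeightedHeight.northcottSet_eq_and_bogomolovSet_eq hp hq hmono hlt hα⟩
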